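/- \textbf{Theorem (Energy decay).} \emph{Setting.} Let $d\in\{1,2,3\}$, let $\Omega\subset\mathbb R^d$ be a non-empty bounded convex domain, let $p\ge 1$, $H=[H_0^1(\Omega)]^p$, and $(v,w)_L=\sum_{j=1}^p (v_j,w_j)_{L^2(\Omega)}$. Let $V_1,\dots,V_p\in L^\infty(\Omega)$ be non-negative a.e., let $K=[\kappa_{ij}]\in\mathbb R^{p\times p}$ be symmetric positive definite with spectral norm $\|K\|_2$, and let $N=\mathrm{diag}(N_1,\dots,N_p)$ with all $N_j>0$. Put $\rho_j(\varphi)=\sum_{i=1}^p\kappa_{ij}|\varphi_i|^2$, $$\mathcal E(\varphi)=\sum_{j=1}^p\int_\Omega \tfrac12\|\nabla\varphi_j\|^2+\tfrac12V_j|\varphi_j|^2+\tfrac14\rho_j(\varphi)|\varphi_j|^2\,dx,\qquad \varphi\in H,$$ $$a_\varphi(v,w)=\sum_{j=1}^p\int_\Omega \nabla v_j\cdot\nabla w_j+V_jv_jw_j+\rho_j(\varphi)v_jw_j\,dx,\qquad \|v\|_{a_\varphi}=a_\varphi(v,v)^{1/2},$$ $$\|v\|_H^2=\sum_{j=1}^p\int_\Omega\|\nabla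 v_j\|^2+V_j|v_j|^2\,dx .$$ For $v,w\in H$ let $[\![v,w]\!]=\mathrm{diag}\big((v_1,w_1)_{L^2(\Omega)},\dots,(v_p,w_p)_{L^2(\Omega)}\big)$. Let $\mathcal{OB}=\{\varphi\in H:[\![\varphi,\varphi]\!]=N\}$, with tangent spaces $T_\varphi\mathcal{OB}=\{z\in H:[\![\varphi,z]\!]=0\}$, and let $\mathcal N(v)=v[\![v,v]\!]^{-1/2}N^{1/2}$. The Riemannian gradient $\mathrm{grad}_a\mathcal E(\varphi)\in T_\varphi\mathcal{OB}$ is defined by $a_\varphi(\mathrm{grad}_a\mathcal E(\varphi),z)=D\mathcal E(\varphi)[z]$ for all $z\in T_\varphi\mathcal{OB}$, and $\mathcal A_\varphi^{-1}\varphi\in H$ denotes the element $u$ with $a_\varphi(u,w)=(\varphi,w)_L$ for all $w\in H$. A sequence $\{\varphi_k\}$ is generated by the energy-adaptive Riemannian gradient descent (eaRGD) method with step sizes $\tau_k$ if $\varphi_0\in\mathcal{OB}$ and, for all $k\ge0$, $$\varphi_{k+1}=\mathcal N\Big(\varphi_k-\tau_k\big(\varphi_k-\mathcal A_{\varphi_k}^{-1}\varphi_k\,N\,[\![\varphi_k,\mathcal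 A_{\varphi_k}^{-1}\varphi_k]\!]^{-1}\big)\Big).$$ The form $a_\varphi$ is called coercive with constant $\alpha>0$ if $a_\varphi(v,v)\ge\alpha\|v\|_H^2$ for all $v\in H$. \emph{(A)} Assume that for every $\varphi\in H$ the form $a_\varphi$ is coercive (with a constant that may depend on $\varphi$). Then there are constants $C_0>0$ and $0<C_\tau\le1$, depending only on $\Omega$, $d$, $\|K\|_2$ and $\|\varphi_0\|_{a_{\varphi_0}}$, such that for every eaRGD sequence with step sizes $0<\tau_{\min}\le\tau_k\le\tau_{\max}\le C_\tau$ and every $k\ge0$: (i) $\|\varphi_k\|_{a_{\varphi_k}}\le C_0$; (ii) $\mathrm{grad}_a\mathcal E(\varphi_k)$ exists and $\mathcal E(\varphi_k)-\mathcal E(\varphi_{k+1})\ge\tfrac12\tau_{\min}\|\mathrm{grad}_a\mathcal E(\varphi_k)\|_{a_{\varphi_k}}^2$. \emph{(B)} If coercivity is only known along the iterates, namely if for some $\alpha>0$ every form $a_{\varphi_k}$, $k\ge0$, is coercive with constant $\alpha$, then the same conclusions hold with constants $C_0>0$ and $0<C_\tau\le1$ that depend only on $\Omega$, $d$, $\|K\|_2$,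 $\|\varphi_0\|_{a_{\varphi_0}}$, $\alpha$ and a positive lower bound $\nu$ for the masses $N_1,\dots,N_p$. -/

import Mathlib

open MeasureTheory
open scoped ContDiff

noncomputable section

namespace GrossPitaevskii

/-- The ambient space `L²(Ω) × L²(Ω; ℝᵈ)` with its Hilbert space norm, in which a function `u` of
class `H¹` is represented by the pair `(u, ∇u)`. -/
abbrev L2Pair {d : ℕ} (Ω : Set (EuclideanSpace ℝ (Fin d))) : Type :=
  WithLp 2 (Lp ℝ 2 (volume.restrict Ω) × Lp (EuclideanSpace ℝ (Fin d)) 2 (volume.restrict Ω))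

/-- `η ∈ C_c^∞(Ω)`. -/
def IsTestFunction {d : ℕ} (Ω : Set (EuclideanSpace ℝ (Fin d)))
    (η : EuclideanSpace ℝ (Fin d) → ℝ) : Prop :=
  ContDiff ℝ ∞ η ∧ HasCompactSupport η ∧ tsupport η ⊆ Ω

/-- The pairs `(η, ∇η)` with `η ∈ C_c^∞(Ω)`. -/
def testPairs {d : ℕ} (Ω : Set (EuclideanSpace ℝ (Fin d))) : Submodule ℝ (L2Pair Ω) where
  carrier := {x | ∃ η : EuclideanSpace ℝ (Fin d) → ℝ, IsTestFunction Ω η ∧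
    (x.fst : EuclideanSpace ℝ (Fin d) → ℝ) =ᵐ[volume.restrict Ω] η ∧
    (x.snd : EuclideanSpace ℝ (Fin d) → EuclideanSpace ℝ (Fin d))
      =ᵐ[volume.restrict Ω] gradient η}
  zero_mem' := by
    refine ⟨0, ⟨contDiff_const, HasCompactSupport.zero, by simp⟩, Lp.coeFn_zero _ _ _, ?_⟩
    filter_upwards [Lp.coeFn_zero (EuclideanSpace ℝ (Fin d)) 2 (volume.restrict Ω)] with x hx
    have h0 : gradient (0 : EuclideanSpace ℝ (Fin d) → ℝ) x = 0 := by simp [gradient]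
    rw [h0]
    exact hx
  add_mem' := by
    rintro a b ⟨η, ⟨h1, h2, h3⟩, ha, ha'⟩ ⟨ζ, ⟨k1, k2, k3⟩, hb, hb'⟩
    refine ⟨η + ζ, ⟨h1.add k1, h2.add k2,
      (tsupport_add η ζ).trans (Set.union_subset h3 k3)⟩, ?_, ?_⟩
    · filter_upwards [Lp.coeFn_add a.fst b.fst, ha, hb] with x hx hx1 hx2
      change (a.fst + b.fst : Lp ℝ 2 (volume.restrict Ω)) x = _
      rw [hx, Pi.add_apply, hx1, hx2, Pi.add_apply]
    · filter_upwards [Lp.coeFn_add a.snd b.snd, ha', hb'] with x hx hx1 hx2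
      change (a.snd + b.snd : Lp (EuclideanSpace ℝ (Fin d)) 2 (volume.restrict Ω)) x = _
      have e1 : DifferentiableAt ℝ η x := (h1.differentiable (by simp)).differentiableAt
      have e2 : DifferentiableAt ℝ ζ x := (k1.differentiable (by simp)).differentiableAt
      rw [hx, Pi.add_apply, hx1, hx2]
      simp only [gradient]
      rw [fderiv_add e1 e2, map_add]
  smul_mem' := by
    rintro c a ⟨η, ⟨h1, h2, h3⟩, ha, ha'⟩
    refine ⟨c • η, ⟨h1.const_smul c, h2.smul_left (f := fun _ => c),
      (tsupport_smul_subset_right (fun _ => c) η).trans h3⟩, ?_, ?_⟩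
    · filter_upwards [Lp.coeFn_smul c a.fst, ha] with x hx hx1
      change (c • a.fst : Lp ℝ 2 (volume.restrict Ω)) x = _
      rw [hx, Pi.smul_apply, hx1, Pi.smul_apply]
    · filter_upwards [Lp.coeFn_smul c a.snd, ha'] with x hx hx1
      change (c • a.snd : Lp (EuclideanSpace ℝ (Fin d)) 2 (volume.restrict Ω)) x = _
      have e1 : DifferentiableAt ℝ η x := (h1.differentiable (by simp)).differentiableAt
      rw [hx, Pi.smul_apply, hx1]
      simp only [gradient]
      rw [fderiv_const_smul e1 c, map_smul]

/-- The Sobolev space `H₀¹(Ω)`: the closure of `C_c^∞(Ω)` in the `H¹`-norm. An element is the pair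
`(u, ∇u)` of a function and its weak gradient. -/
abbrev H01 {d : ℕ} (Ω : Set (EuclideanSpace ℝ (Fin d))) : Submodule ℝ (L2Pair Ω) :=
  (testPairs Ω).topologicalClosure

/-- The function underlying an element of `H₀¹(Ω)`. -/
def fn {d : ℕ} {Ω : Set (EuclideanSpace ℝ (Fin d))} (u : H01 Ω) :
    EuclideanSpace ℝ (Fin d) → ℝ := ((u : L2Pair Ω).fst : EuclideanSpace ℝ (Fin d) → ℝ)

/-- The weak gradient of an element of `H₀¹(Ω)`. -/
def grad {d : ℕ} {Ω : Set (EuclideanSpace ℝ (Fin d))} (u : H01 Ω) :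
    EuclideanSpace ℝ (Fin d) → EuclideanSpace ℝ (Fin d) :=
  ((u : L2Pair Ω).snd : EuclideanSpace ℝ (Fin d) → EuclideanSpace ℝ (Fin d))

/-- The space `H = [H₀¹(Ω)]ᵖ` of `p`-frames. -/
abbrev Frame {d : ℕ} (Ω : Set (EuclideanSpace ℝ (Fin d))) (p : ℕ) : Type := Fin p → H01 Ω

variable {d : ℕ} {Ω : Set (EuclideanSpace ℝ (Fin d))} {p : ℕ}

/-- The diagonal matrix of the component-wise `L²`-inner products of two frames. Diagonal
`p × p` matrices are represented by the vector of their diagonal entries. -/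
def out (v w : Frame Ω p) (j : Fin p) : ℝ := ∫ x in Ω, fn (v j) x * fn (w j) x

/-- The inner product of `L = [L²(Ω)]ᵖ`. -/
def innerL (v w : Frame Ω p) : ℝ := ∑ j, out v w j

/-- The frame `v Λ`, for a diagonal matrix `Λ`. -/
def scale (v : Frame Ω p) (Λ : Fin p → ℝ) : Frame Ω p := fun j => Λ j • v j

/-- `V_j ∈ L^∞(Ω)` and `V_j ≥ 0` almost everywhere in `Ω`. -/
def IsPotential (Ω : Set (EuclideanSpace ℝ (Fin d)))
    (V : Fin p → EuclideanSpace ℝ (Fin d) → ℝ) : Prop :=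
  ∀ j, MemLp (V j) ⊤ (volume.restrict Ω) ∧ ∀ᵐ x ∂(volume.restrict Ω), 0 ≤ V j x

/-- The spectral norm of a matrix. -/
def spectralNorm (K : Matrix (Fin p) (Fin p) ℝ) : ℝ :=
  ‖Matrix.toEuclideanCLM (n := Fin p) (𝕜 := ℝ) K‖

/-- `ρ_j(φ) = ∑ᵢ κᵢⱼ |φᵢ|²`. -/
def rho (K : Matrix (Fin p) (Fin p) ℝ) (φ : Frame Ω p) (j : Fin p)
    (x : EuclideanSpace ℝ (Fin d)) : ℝ := ∑ i, K i j * fn (φ i) x ^ 2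

/-- The energy functional. -/
def energy (V : Fin p → EuclideanSpace ℝ (Fin d) → ℝ) (K : Matrix (Fin p) (Fin p) ℝ)
    (φ : Frame Ω p) : ℝ :=
  ∑ j, ∫ x in Ω, (1 / 2 * ‖grad (φ j) x‖ ^ 2 + 1 / 2 * (V j x * fn (φ j) x ^ 2)
    + 1 / 4 * (rho K φ j x * fn (φ j) x ^ 2))

/-- The potential-dependent inner product of `H`. -/
def innerH (V : Fin p → EuclideanSpace ℝ (Fin d) → ℝ) (v w : Frame Ω p) : ℝ :=
  ∑ j, ∫ x in Ω, (inner ℝ (grad (v j) x) (grad (w j) x) + V j x * (fn (v j) x * fn (w j) x))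

/-- The bilinear form `a_φ`. -/
def aForm (V : Fin p → EuclideanSpace ℝ (Fin d) → ℝ) (K : Matrix (Fin p) (Fin p) ℝ)
    (φ v w : Frame Ω p) : ℝ :=
  ∑ j, ∫ x in Ω, (inner ℝ (grad (v j) x) (grad (w j) x) + V j x * (fn (v j) x * fn (w j) x)
    + rho K φ j x * (fn (v j) x * fn (w j) x))

/-- The energy norm `‖v‖_{a_φ}`. -/
def aNorm (V : Fin p → EuclideanSpace ℝ (Fin d) → ℝ) (K : Matrix (Fin p) (Fin p) ℝ)
    (φ v : Frame Ω p) : ℝ := √(aForm V K φ v v)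

/-- `a_φ` is coercive on `H` with constant `α`: `a_φ(v, v) ≥ α ‖v‖_H²` for all `v ∈ H`. -/
def CoerciveWith (V : Fin p → EuclideanSpace ℝ (Fin d) → ℝ) (K : Matrix (Fin p) (Fin p) ℝ)
    (φ : Frame Ω p) (α : ℝ) : Prop :=
  ∀ v : Frame Ω p, α * innerH V v v ≤ aForm V K φ v v

/-- The generalised oblique manifold of frames with masses `N`. -/
def obliqueManifold (Ω : Set (EuclideanSpace ℝ (Fin d))) (N : Fin p → ℝ) : Set (Frame Ω p) :=
  {φ | ∀ j, out φ φ j = N j}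

/-- The tangent space of the generalised oblique manifold at `φ`. -/
def tangentSpace (φ : Frame Ω p) : Set (Frame Ω p) := {z | ∀ j, out φ z j = 0}

/-- `g` is the Riemannian gradient `grad_a E(φ)` with respect to the energy-adaptive metric: the
element `g` of the tangent space with `a_φ(g, z) = DE(φ)[z]` for all tangent `z`. -/
def IsRiemannianGradient (V : Fin p → EuclideanSpace ℝ (Fin d) → ℝ)
    (K : Matrix (Fin p) (Fin p) ℝ) (φ g : Frame Ω p) : Prop :=
  g ∈ tangentSpace φ ∧
    ∀ z ∈ tangentSpace φ, HasDerivAt (fun t : ℝ => energy V K (φ + t • z)) (aForm V K φ g z) 0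

/-- The component-wise normalisation `v ↦ v ⟦v,v⟧^{-1/2} N^{1/2}`. -/
def normalise (N : Fin p → ℝ) (v : Frame Ω p) : Frame Ω p :=
  scale v (fun j => (√(out v v j))⁻¹ * √(N j))

/-- `u = A_φ⁻¹ f`, where `⟨A_φ v, w⟩ = a_φ(v, w)` and `f ∈ H` is identified with the functional
`w ↦ (f, w)_L` on `H`. -/
def IsHamiltonianPreimage (V : Fin p → EuclideanSpace ℝ (Fin d) → ℝ)
    (K : Matrix (Fin p) (Fin p) ℝ) (φ f u : Frame Ω p) : Prop :=
  ∀ w : Frame Ω p, aForm V K φ u w = innerL f w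

/-- One step `φ ↦ 𝒩(φ - τ (φ - A_φ⁻¹φ N ⟦φ, A_φ⁻¹φ⟧⁻¹))` of the energy-adaptive Riemannian
gradient descent method. -/
def IsStep (V : Fin p → EuclideanSpace ℝ (Fin d) → ℝ) (K : Matrix (Fin p) (Fin p) ℝ)
    (N : Fin p → ℝ) (τ : ℝ) (φ φ' : Frame Ω p) : Prop :=
  ∃ u : Frame Ω p, IsHamiltonianPreimage V K φ φ u ∧
    φ' = normalise N (φ - τ • (φ - scale u (fun j => N j * (out φ u j)⁻¹)))

/-- `φ 0, φ 1, …` is generated by the energy-adaptive Riemannian gradient descent method with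
step sizes `τ 0, τ 1, …` and an initial guess on the generalised oblique manifold. -/
def IsEaRGD (V : Fin p → EuclideanSpace ℝ (Fin d) → ℝ) (K : Matrix (Fin p) (Fin p) ℝ)
    (N : Fin p → ℝ) (τ : ℕ → ℝ) (φ : ℕ → Frame Ω p) : Prop :=
  φ 0 ∈ obliqueManifold Ω N ∧ ∀ k, IsStep V K N (τ k) (φ k) (φ (k + 1))

/-- The iterates are bounded by `C₀` in the energy norm, and the energy decays in each step by at
least `τmin / 2` times the squared energy norm of the Riemannian gradient. -/
def BoundedWithDecay (V : Fin p → EuclideanSpace ℝ (Fin d) → ℝ)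
    (K : Matrix (Fin p) (Fin p) ℝ) (φ : ℕ → Frame Ω p) (C₀ τmin : ℝ) : Prop :=
  ∀ k, aNorm V K (φ k) (φ k) ≤ C₀ ∧
    ∃ g : Frame Ω p, IsRiemannianGradient V K (φ k) g ∧
      1 / 2 * τmin * aNorm V K (φ k) g ^ 2 ≤ energy V K (φ k) - energy V K (φ (k + 1))

end GrossPitaevskii

end

noncomputable section

namespace GrossPitaevskii

variable {d : ℕ} {Ω : Set (EuclideanSpace ℝ (Fin d))} {p : ℕ}

open Filter Topology
open scoped ENNReal NNReal

/-! Write h for `innerH` and q for `quad`, so that the energy is h(φ,φ)/2 + q(φ,φ,φ,φ)/4 and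
a_φ(v,w) = h(v,w) + q(φ,φ,v,w). Then DE(φ) = a_φ(φ,·), and the search direction g = φ - A_φ⁻¹φ
N⟦φ,A_φ⁻¹φ⟧⁻¹ is the a_φ-orthogonal projection of φ onto the tangent space (`gradient_spec`). It is
therefore the Riemannian gradient, with a_φ(g,g) = a_φ(φ,g) ≤ a_φ(φ,φ).

The energy is a quartic polynomial along φ - τg. Its linear term is -τ a_φ(g,g), and the embedding
of H₀¹ into L⁴ bounds the rest by a multiple of τ² a_φ(g,g) (`energy_gradient_step_le`). By tangency
the step changes the masses only by τ²⟦g,g⟧ ≥ 0, so the normalisation shrinks each component by a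
factor that differs from 1 at second order. In (A), coercivity for all frames forces every
κᵢⱼ∫|vᵢ|²|vⱼ|² to be non-negative, and shrinking cannot raise the energy
(`energy_scale_le_of_nonneg`). In (B) it raises the energy by at most a multiple of τ² a_φ(g,g)
(`energy_scale_le`, `energy_normalise_le`).

Thus E(φₖ₊₁) ≤ E(φₖ) - (τ - τ²M) a(g,g), and τM ≤ 1/2 gives the decay. The constant M needs a bound
B on a_φ(φ,φ) that is uniform in k. Since E(φ) ≤ a_φ(φ,φ)/2 ≤ 2E(φ), decay of the energy up to step
k keeps B = 2R² valid there, where R is the initial energy norm, and the induction closes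
(`boundedWithDecay`). -/

/-! ### Sobolev embedding of H₀¹(Ω) into L⁴(Ω) and L²(Ω) -/

theorem norm_gradient (η : EuclideanSpace ℝ (Fin d) → ℝ) (x : EuclideanSpace ℝ (Fin d)) :
    ‖gradient η x‖ = ‖fderiv ℝ η x‖ := by
  simp [gradient]

/-- In one dimension a test function is bounded by the `L¹`-norm of its derivative. -/
theorem enorm_le_eLpNorm_fderiv_one {η : EuclideanSpace ℝ (Fin 1) → ℝ} (hη : ContDiff ℝ 1 η)
    (hc : HasCompactSupport η) (x : EuclideanSpace ℝ (Fin 1)) :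
    ‖η x‖ₑ ≤ eLpNorm (fderiv ℝ η) 1 volume := by
  let e : ℝ ≃ₗᵢ[ℝ] EuclideanSpace ℝ (Fin 1) := (OrthonormalBasis.singleton (Fin 1) ℝ).repr
  have hsmooth : ContDiff ℝ 1 (η ∘ e) := hη.comp e.toContinuousLinearEquiv.contDiff
  have hcomp : HasCompactSupport (η ∘ e) :=
    hc.comp_homeomorph e.toHomeomorph
  have h := HasCompactSupport.enorm_le_lintegral_Ici_deriv hsmooth hcomp (e.symm x)
  simp only [Function.comp_apply, LinearIsometryEquiv.apply_symm_apply] at h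
  refine h.trans ((lintegral_mono' Measure.restrict_le_self le_rfl).trans ?_)
  rw [eLpNorm_one_eq_lintegral_enorm]
  have hmp := e.measurePreserving
  rw [← hmp.lintegral_comp_emb e.toHomeomorph.measurableEmbedding]
  refine lintegral_mono fun t => ?_
  have hd : HasDerivAt (η ∘ e) (fderiv ℝ η (e t) (e 1)) t := by
    have h1 : HasFDerivAt η (fderiv ℝ η (e t)) (e t) :=
      ((hη.differentiable one_ne_zero) (e t)).hasFDerivAt
    have h2 : HasDerivAt e (e 1) t := by
      simpa using (e.toContinuousLinearEquiv.toContinuousLinearMap.hasDerivAt (x := t))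
    exact h1.comp_hasDerivAt t h2
  rw [hd.deriv]
  refine (ContinuousLinearMap.le_opENorm _ _).trans ?_
  simp

/-- The Sobolev inequality for test functions. -/
theorem exists_eLpNorm_four_le_of_isTestFunction (hd : 1 ≤ d ∧ d ≤ 3)
    (hΩb : Bornology.IsBounded Ω) :
    ∃ C : ℝ≥0, ∀ η : EuclideanSpace ℝ (Fin d) → ℝ, IsTestFunction Ω η →
      eLpNorm η 4 (volume.restrict Ω) ≤ C * eLpNorm (gradient η) 2 (volume.restrict Ω) := by
  have hfin : volume Ω ≠ ⊤ := hΩb.measure_lt_top.ne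
  -- Since Ω has finite measure, Hölder's inequality reduces the claim to a bound by the L^r-norm of
  -- the derivative for a single r ≤ 2.
  have key : ∀ (r : ℝ≥0) (C : ℝ≥0) (_ : r ≤ 2),
      (∀ η : EuclideanSpace ℝ (Fin d) → ℝ, IsTestFunction Ω η →
        eLpNorm η 4 (volume.restrict Ω) ≤ C * eLpNorm (fderiv ℝ η) r volume) →
      ∃ C : ℝ≥0, ∀ η : EuclideanSpace ℝ (Fin d) → ℝ, IsTestFunction Ω η →
        eLpNorm η 4 (volume.restrict Ω) ≤ C * eLpNorm (gradient η) 2 (volume.restrict Ω) := by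
    intro r C hr h
    -- `eLpNorm` with exponent 0 is 0, so in this case the left-hand side vanishes.
    by_cases hr0 : r = 0
    · refine ⟨0, fun η hη => ?_⟩
      simpa [hr0] using h η hη
    have hexp : 0 ≤ 1 / (r : ℝ≥0∞).toReal - 1 / (2 : ℝ≥0∞).toReal := by
      have : (0 : ℝ) < r := by positivity
      have h2 : (r : ℝ) ≤ 2 := by exact_mod_cast hr
      rw [sub_nonneg]
      simp only [ENNReal.coe_toReal, ENNReal.toReal_ofNat]
      exact one_div_le_one_div_of_le this h2
    set M : ℝ≥0∞ := volume Ω ^ (1 / (r : ℝ≥0∞).toReal - 1 / (2 : ℝ≥0∞).toReal) with hM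
    have hMtop : M ≠ ⊤ := ENNReal.rpow_ne_top_of_nonneg hexp hfin
    refine ⟨C * M.toNNReal, fun η hη => (h η hη).trans ?_⟩
    have hsupp : (fderiv ℝ η).support ⊆ Ω :=
      (support_fderiv_subset ℝ).trans hη.2.2
    have hmeas : Continuous (fderiv ℝ η) := hη.1.continuous_fderiv (by simp)
    rw [← eLpNorm_restrict_eq_of_support_subset (f := fderiv ℝ η) hsupp, ENNReal.coe_mul,
      ENNReal.coe_toNNReal hMtop, mul_assoc]
    gcongr
    have h1 := eLpNorm_le_eLpNorm_mul_rpow_measure_univ (μ := volume.restrict Ω)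
      (p := r) (q := 2) (by exact_mod_cast hr) hmeas.aestronglyMeasurable
    rw [Measure.restrict_apply_univ, ← hM, mul_comm] at h1
    refine h1.trans (le_of_eq ?_)
    congr 1
    exact eLpNorm_congr_norm_ae (ae_of_all _ fun x => (norm_gradient η x).symm)
  -- The Gagliardo–Nirenberg–Sobolev inequality, which needs r < d.
  have hsob : ∀ (r : ℝ≥0), 1 ≤ r → r ≤ 2 → (r : ℝ≥0) < d →
      ((r : ℝ)⁻¹ - (d : ℝ)⁻¹ ≤ (4 : ℝ)⁻¹) →
      ∃ C : ℝ≥0, ∀ η : EuclideanSpace ℝ (Fin d) → ℝ, IsTestFunction Ω η →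
        eLpNorm η 4 (volume.restrict Ω) ≤ C * eLpNorm (gradient η) 2 (volume.restrict Ω) := by
    intro r h1 h2 h3 h4
    refine key r (eLpNormLESNormFDerivOfLeConst ℝ
      (volume : Measure (EuclideanSpace ℝ (Fin d))) Ω r 4) h2 fun η hη => ?_
    have hs : η.support ⊆ Ω := (subset_tsupport η).trans hη.2.2
    rw [eLpNorm_restrict_eq_of_support_subset hs]
    exact eLpNorm_le_eLpNorm_fderiv_of_le (q := 4) volume (hη.1.of_le (by simp)) hs h1
      (by simpa using h3) (by simpa using h4) hΩb
  obtain ⟨h1, h3⟩ := hd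
  -- For d = 1 no r ≥ 1 lies below d, and the sup bound is used with r = 1. For d = 2 the choice r =
  -- 2 is excluded, and r = 4/3 meets the exponent condition with equality. For d = 3, r = 2 gives
  -- 1/2 - 1/3 ≤ 1/4.
  interval_cases d
  · have hexp : (0 : ℝ) ≤ (4 : ℝ≥0∞).toReal⁻¹ := by positivity
    have hMtop : volume Ω ^ (4 : ℝ≥0∞).toReal⁻¹ ≠ ⊤ := ENNReal.rpow_ne_top_of_nonneg hexp hfin
    refine key 1 (volume Ω ^ (4 : ℝ≥0∞).toReal⁻¹).toNNReal one_le_two fun η hη => ?_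
    rw [ENNReal.coe_toNNReal hMtop, mul_comm]
    have := eLpNorm_le_of_ae_enorm_bound (μ := volume.restrict Ω) (p := 4)
      (ae_of_all _ fun x => enorm_le_eLpNorm_fderiv_one (hη.1.of_le (by simp)) hη.2.1 x)
    simpa using this
  · refine hsob (4 / 3) ?_ ?_ ?_ ?_
    · rw [← NNReal.coe_le_coe]; norm_num
    · rw [← NNReal.coe_le_coe]; norm_num
    · rw [← NNReal.coe_lt_coe]; norm_num
    · norm_num
  · refine hsob 2 ?_ ?_ ?_ ?_ <;> norm_num

/-- The Sobolev inequality in `H₀¹(Ω)`. -/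
theorem exists_eLpNorm_four_le (hd : 1 ≤ d ∧ d ≤ 3) (hΩb : Bornology.IsBounded Ω) :
    ∃ C : ℝ≥0, ∀ u : H01 Ω,
      eLpNorm (fn u) 4 (volume.restrict Ω) ≤ C * eLpNorm (grad u) 2 (volume.restrict Ω) := by
  obtain ⟨C, hC⟩ := exists_eLpNorm_four_le_of_isTestFunction hd hΩb
  refine ⟨C, fun u => ?_⟩
  obtain ⟨w, hw, hlim⟩ := mem_closure_iff_seq_limit.1 u.2
  have hfst : Tendsto (fun n => (w n).fst) atTop (𝓝 (u : L2Pair Ω).fst) :=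
    ((WithLp.continuous_fst 2 _ _).tendsto _).comp hlim
  have hsnd : Tendsto (fun n => (w n).snd) atTop (𝓝 (u : L2Pair Ω).snd) :=
    ((WithLp.continuous_snd 2 _ _).tendsto _).comp hlim
  -- An almost everywhere convergent subsequence allows Fatou's lemma for the L⁴-norm, while the
  -- gradients converge in L².
  obtain ⟨ns, hns, hae⟩ := (tendstoInMeasure_of_tendsto_Lp hfst).exists_seq_tendsto_ae
  have hbound : ∀ n, eLpNorm ((w n).fst : EuclideanSpace ℝ (Fin d) → ℝ) 4 (volume.restrict Ω)
      ≤ C * ‖(w n).snd‖ₑ := by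
    intro n
    obtain ⟨η, hη, h1, h2⟩ := hw n
    rw [eLpNorm_congr_ae h1, Lp.enorm_def, eLpNorm_congr_ae h2]
    exact hC η hη
  refine (Lp.eLpNorm_lim_le_liminf_eLpNorm
    (fun n => Lp.aestronglyMeasurable (w (ns n)).fst) _ hae).trans ?_
  have hlim' : Tendsto (fun n => (C : ℝ≥0∞) * ‖(w (ns n)).snd‖ₑ) atTop
      (𝓝 (C * ‖(u : L2Pair Ω).snd‖ₑ)) := by
    refine ENNReal.Tendsto.const_mul ?_ (Or.inr ENNReal.coe_ne_top)
    exact (continuous_enorm.tendsto _).comp (hsnd.comp hns.tendsto_atTop)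
  refine (liminf_le_liminf (Eventually.of_forall fun n => hbound (ns n))).trans ?_
  rw [hlim'.liminf_eq, Lp.enorm_def]
  rfl

/-- `H₀¹(Ω)` embeds into `L⁴(Ω)` and `L²(Ω)`, with norms controlled by the weak gradient. -/
structure SobolevEmbedding (Ω : Set (EuclideanSpace ℝ (Fin d))) (S : ℝ) : Prop where
  nonneg : 0 ≤ S
  memLp_four : ∀ u : H01 Ω, MemLp (fn u) 4 (volume.restrict Ω)
  integral_pow_four_le : ∀ u : H01 Ω,
    ∫ x in Ω, fn u x ^ 4 ≤ S * (∫ x in Ω, ‖grad u x‖ ^ 2) ^ 2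
  integral_sq_le : ∀ u : H01 Ω, ∫ x in Ω, fn u x ^ 2 ≤ S * ∫ x in Ω, ‖grad u x‖ ^ 2

theorem memLp_fn_two (u : H01 Ω) : MemLp (fn u) 2 (volume.restrict Ω) := Lp.memLp _

theorem memLp_grad (u : H01 Ω) : MemLp (grad u) 2 (volume.restrict Ω) := Lp.memLp _

theorem eLpNorm_two_pow_two {E : Type*} [NormedAddCommGroup E] {α : Type*} [MeasurableSpace α]
    {μ : Measure α} {f : α → E} (hf : MemLp f 2 μ) :
    eLpNorm f 2 μ ^ 2 = ENNReal.ofReal (∫ x, ‖f x‖ ^ 2 ∂μ) := by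
  have h0 : 0 ≤ ∫ x, ‖f x‖ ^ 2 ∂μ := integral_nonneg fun x => by positivity
  rw [hf.eLpNorm_eq_integral_rpow_norm (by simp) (by simp), ← ENNReal.ofReal_pow (by positivity)]
  congr 1
  simp only [ENNReal.toReal_ofNat, Real.rpow_ofNat]
  rw [← Real.rpow_natCast, ← Real.rpow_mul h0]
  norm_num

theorem eLpNorm_four_pow_four {E : Type*} [NormedAddCommGroup E] {α : Type*} [MeasurableSpace α]
    {μ : Measure α} {f : α → E} (hf : MemLp f 4 μ) :
    eLpNorm f 4 μ ^ 4 = ENNReal.ofReal (∫ x, ‖f x‖ ^ 4 ∂μ) := by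
  have h0 : 0 ≤ ∫ x, ‖f x‖ ^ 4 ∂μ := integral_nonneg fun x => by positivity
  rw [hf.eLpNorm_eq_integral_rpow_norm (by simp) (by simp), ← ENNReal.ofReal_pow (by positivity)]
  congr 1
  simp only [ENNReal.toReal_ofNat, Real.rpow_ofNat]
  rw [← Real.rpow_natCast, ← Real.rpow_mul h0]
  norm_num

theorem exists_sobolevEmbedding (hd : 1 ≤ d ∧ d ≤ 3) (hΩb : Bornology.IsBounded Ω) :
    ∃ S, SobolevEmbedding Ω S := by
  obtain ⟨C, hC⟩ := exists_eLpNorm_four_le hd hΩb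
  have hfin : volume Ω ≠ ⊤ := hΩb.measure_lt_top.ne
  have hexp : 0 ≤ 1 / (2 : ℝ≥0∞).toReal - 1 / (4 : ℝ≥0∞).toReal := by norm_num
  set M : ℝ≥0∞ := volume Ω ^ (1 / (2 : ℝ≥0∞).toReal - 1 / (4 : ℝ≥0∞).toReal) with hM
  have hMtop : M ≠ ⊤ := ENNReal.rpow_ne_top_of_nonneg hexp hfin
  have hmem : ∀ u : H01 Ω, MemLp (fn u) 4 (volume.restrict Ω) := fun u =>
    ⟨(memLp_fn_two u).1, (hC u).trans_lt
      (ENNReal.mul_lt_top ENNReal.coe_lt_top (memLp_grad u).2)⟩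
  have hgn : ∀ u : H01 Ω, 0 ≤ ∫ x in Ω, ‖grad u x‖ ^ 2 := fun u =>
    integral_nonneg fun x => by positivity
  have h4 : ∀ u : H01 Ω,
      ∫ x in Ω, fn u x ^ 4 ≤ (C : ℝ) ^ 4 * (∫ x in Ω, ‖grad u x‖ ^ 2) ^ 2 := by
    intro u
    have h := pow_le_pow_left' (hC u) 4
    rw [eLpNorm_four_pow_four (hmem u), mul_pow,
      show eLpNorm (grad u) 2 (volume.restrict Ω) ^ 4
        = (eLpNorm (grad u) 2 (volume.restrict Ω) ^ 2) ^ 2 by rw [← pow_mul], eLpNorm_two_pow_two (memLp_grad u),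
      ← ENNReal.ofReal_pow (hgn u), ← ENNReal.ofReal_coe_nnreal,
      ← ENNReal.ofReal_pow C.coe_nonneg, ← ENNReal.ofReal_mul (by positivity),
      ENNReal.ofReal_le_ofReal_iff (by have := hgn u; positivity)] at h
    refine le_trans (le_of_eq ?_) h
    congr 1 with x
    rw [Real.norm_eq_abs, Even.pow_abs (by decide)]
  have h2 : ∀ u : H01 Ω,
      ∫ x in Ω, fn u x ^ 2 ≤ (C * M.toNNReal : ℝ) ^ 2 * ∫ x in Ω, ‖grad u x‖ ^ 2 := by
    intro u
    have h1 := eLpNorm_le_eLpNorm_mul_rpow_measure_univ (μ := volume.restrict Ω)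
      (p := 2) (q := 4) (by norm_num) (memLp_fn_two u).1
    rw [Measure.restrict_apply_univ, ← hM] at h1
    have h3 : eLpNorm (fn u) 2 (volume.restrict Ω)
        ≤ (C * M.toNNReal : ℝ≥0) * eLpNorm (grad u) 2 (volume.restrict Ω) := by
      refine h1.trans ((mul_le_mul_left (hC u) M).trans (le_of_eq ?_))
      rw [ENNReal.coe_mul, ENNReal.coe_toNNReal hMtop]
      ring
    have h := pow_le_pow_left' h3 2
    rw [eLpNorm_two_pow_two (memLp_fn_two u), mul_pow, eLpNorm_two_pow_two (memLp_grad u),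
      ← ENNReal.ofReal_coe_nnreal, ← ENNReal.ofReal_pow (NNReal.coe_nonneg _),
      ← ENNReal.ofReal_mul (by positivity),
      ENNReal.ofReal_le_ofReal_iff (by have := hgn u; positivity)] at h
    refine le_trans (le_of_eq ?_) (h.trans (le_of_eq ?_))
    · simp
    · push_cast; ring
  refine ⟨max ((C : ℝ) ^ 4) ((C * M.toNNReal : ℝ) ^ 2), le_max_of_le_left (by positivity),
    hmem, fun u => (h4 u).trans ?_, fun u => (h2 u).trans ?_⟩
  · have := hgn u
    gcongr
    exact le_max_left _ _
  · have := hgn u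
    gcongr
    exact le_max_right _ _

/-! ### Componentwise bilinear forms -/

theorem fn_add (u w : H01 Ω) : fn (u + w) =ᵐ[volume.restrict Ω] fun x => fn u x + fn w x :=
  Lp.coeFn_add (u : L2Pair Ω).fst (w : L2Pair Ω).fst

theorem fn_smul (c : ℝ) (u : H01 Ω) : fn (c • u) =ᵐ[volume.restrict Ω] fun x => c * fn u x :=
  Lp.coeFn_smul c (u : L2Pair Ω).fst

theorem grad_add (u w : H01 Ω) :
    grad (u + w) =ᵐ[volume.restrict Ω] fun x => grad u x + grad w x :=
  Lp.coeFn_add (u : L2Pair Ω).snd (w : L2Pair Ω).snd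

theorem grad_smul (c : ℝ) (u : H01 Ω) :
    grad (c • u) =ᵐ[volume.restrict Ω] fun x => c • grad u x :=
  Lp.coeFn_smul c (u : L2Pair Ω).snd

theorem integrable_fn_mul_fn (u w : H01 Ω) :
    Integrable (fun x => fn u x * fn w x) (volume.restrict Ω) :=
  (memLp_fn_two u).integrable_mul (memLp_fn_two w)

theorem integrable_potential {W : EuclideanSpace ℝ (Fin d) → ℝ}
    (hW : MemLp W ⊤ (volume.restrict Ω)) (u w : H01 Ω) :
    Integrable (fun x => W x * (fn u x * fn w x)) (volume.restrict Ω) :=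
  (integrable_fn_mul_fn u w).mul_of_top_right hW

theorem integrable_inner_grad (u w : H01 Ω) :
    Integrable (fun x => inner ℝ (grad u x) (grad w x)) (volume.restrict Ω) :=
  L2.integrable_inner (𝕜 := ℝ) (u : L2Pair Ω).snd (w : L2Pair Ω).snd

/-- The contribution of one component to `innerH`. -/
def compInner (W : EuclideanSpace ℝ (Fin d) → ℝ) (u w : H01 Ω) : ℝ :=
  ∫ x in Ω, (inner ℝ (grad u x) (grad w x) + W x * (fn u x * fn w x))

theorem innerH_eq_sum (V : Fin p → EuclideanSpace ℝ (Fin d) → ℝ) (v w : Frame Ω p) :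
    innerH V v w = ∑ j, compInner (V j) (v j) (w j) := rfl

theorem integrable_compInner {W : EuclideanSpace ℝ (Fin d) → ℝ}
    (hW : MemLp W ⊤ (volume.restrict Ω)) (u w : H01 Ω) :
    Integrable (fun x => inner ℝ (grad u x) (grad w x) + W x * (fn u x * fn w x))
      (volume.restrict Ω) :=
  (integrable_inner_grad u w).add (integrable_potential hW u w)

theorem compInner_comm (W : EuclideanSpace ℝ (Fin d) → ℝ) (u w : H01 Ω) :
    compInner W u w = compInner W w u := by
  unfold compInner
  simp only [real_inner_comm, mul_comm]

theorem compInner_add_left {W : EuclideanSpace ℝ (Fin d) → ℝ}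
    (hW : MemLp W ⊤ (volume.restrict Ω)) (u u' w : H01 Ω) :
    compInner W (u + u') w = compInner W u w + compInner W u' w := by
  unfold compInner
  rw [← integral_add (integrable_compInner hW u w) (integrable_compInner hW u' w)]
  refine integral_congr_ae ?_
  filter_upwards [fn_add u u', grad_add u u'] with x h1 h2
  rw [h1, h2, inner_add_left]
  ring

theorem compInner_smul_left (W : EuclideanSpace ℝ (Fin d) → ℝ) (c : ℝ) (u w : H01 Ω) :
    compInner W (c • u) w = c * compInner W u w := by
  unfold compInner
  rw [← integral_const_mul]
  refine integral_congr_ae ?_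
  filter_upwards [fn_smul c u, grad_smul c u] with x h1 h2
  rw [h1, h2, real_inner_smul_left]
  ring

theorem integral_norm_grad_sq_le_compInner {W : EuclideanSpace ℝ (Fin d) → ℝ}
    (hW : MemLp W ⊤ (volume.restrict Ω)) (hW0 : ∀ᵐ x ∂(volume.restrict Ω), 0 ≤ W x)
    (u : H01 Ω) : ∫ x in Ω, ‖grad u x‖ ^ 2 ≤ compInner W u u := by
  unfold compInner
  refine integral_mono_ae ?_ (integrable_compInner hW u u) ?_
  · simpa only [real_inner_self_eq_norm_sq] using integrable_inner_grad u u
  · filter_upwards [hW0] with x hx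
    simp only [real_inner_self_eq_norm_sq]
    nlinarith [mul_nonneg hx (mul_self_nonneg (fn u x))]

theorem integral_norm_grad_sq_nonneg (u : H01 Ω) : 0 ≤ ∫ x in Ω, ‖grad u x‖ ^ 2 :=
  integral_nonneg fun x => by positivity

/-! ### Integrals of products of four functions -/

/-- The integral of a product of four functions of class `H₀¹`. -/
def prodIntegral (a b c e : H01 Ω) : ℝ := ∫ x in Ω, (fn a x * fn b x) * (fn c x * fn e x)

theorem SobolevEmbedding.memLp_mul {S : ℝ} (hS : SobolevEmbedding Ω S) (a b : H01 Ω) :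
    MemLp (fun x => fn a x * fn b x) 2 (volume.restrict Ω) := by
  have : ENNReal.HolderTriple 4 4 2 := ⟨by
    rw [← two_mul, show (4 : ENNReal) = 2 * 2 by norm_num,
      ENNReal.mul_inv (by simp) (by simp), ← mul_assoc, ENNReal.mul_inv_cancel (by simp) (by simp),
      one_mul]⟩
  exact (hS.memLp_four b).mul (hS.memLp_four a)

theorem SobolevEmbedding.integrable_prod {S : ℝ} (hS : SobolevEmbedding Ω S) (a b c e : H01 Ω) :
    Integrable (fun x => (fn a x * fn b x) * (fn c x * fn e x)) (volume.restrict Ω) :=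
  (hS.memLp_mul a b).integrable_mul (hS.memLp_mul c e)

theorem prodIntegral_swap_left (a b c e : H01 Ω) :
    prodIntegral a b c e = prodIntegral b a c e := by
  unfold prodIntegral
  simp only [mul_comm (fn a _)]

theorem prodIntegral_swap_right (a b c e : H01 Ω) :
    prodIntegral a b c e = prodIntegral a b e c := by
  unfold prodIntegral
  simp only [mul_comm (fn c _)]

theorem prodIntegral_swap_pairs (a b c e : H01 Ω) :
    prodIntegral a b c e = prodIntegral c e a b := by
  unfold prodIntegral
  simp only [mul_comm (fn a _ * fn b _)]

theorem SobolevEmbedding.prodIntegral_add {S : ℝ} (hS : SobolevEmbedding Ω S)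
    (a a' b c e : H01 Ω) :
    prodIntegral (a + a') b c e = prodIntegral a b c e + prodIntegral a' b c e := by
  unfold prodIntegral
  rw [← integral_add (hS.integrable_prod a b c e) (hS.integrable_prod a' b c e)]
  refine integral_congr_ae ?_
  filter_upwards [fn_add a a'] with x h1
  rw [h1]
  ring

theorem prodIntegral_smul (t : ℝ) (a b c e : H01 Ω) :
    prodIntegral (t • a) b c e = t * prodIntegral a b c e := by
  unfold prodIntegral
  rw [← integral_const_mul]
  refine integral_congr_ae ?_
  filter_upwards [fn_smul t a] with x h1
  rw [h1]
  ring

theorem SobolevEmbedding.prodIntegral_self_le {S : ℝ} (hS : SobolevEmbedding Ω S) (a b : H01 Ω) :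
    prodIntegral a b a b ≤ S * ((∫ x in Ω, ‖grad a x‖ ^ 2) * ∫ x in Ω, ‖grad b x‖ ^ 2) := by
  set A := ∫ x in Ω, ‖grad a x‖ ^ 2 with hA
  set B := ∫ x in Ω, ‖grad b x‖ ^ 2 with hB
  have hA0 : 0 ≤ A := integral_norm_grad_sq_nonneg a
  have hB0 : 0 ≤ B := integral_norm_grad_sq_nonneg b
  have hi : ∀ u : H01 Ω, Integrable (fun x => fn u x ^ 4) (volume.restrict Ω) := fun u => by
    refine (hS.integrable_prod u u u u).congr (ae_of_all _ fun x => ?_)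
    ring
  -- Weighted Young inequality in place of Cauchy–Schwarz; the weights are optimised below.
  have key : ∀ s t : ℝ, s * t = 1 →
      2 * prodIntegral a b a b ≤ S * ((s * A) ^ 2 + (t * B) ^ 2) := by
    intro s t hst
    have h1 : 2 * prodIntegral a b a b
        ≤ ∫ x in Ω, (s ^ 2 * fn a x ^ 4 + t ^ 2 * fn b x ^ 4) := by
      unfold prodIntegral
      rw [← integral_const_mul]
      refine integral_mono ((hS.integrable_prod a b a b).const_mul 2)
        (((hi a).const_mul _).add ((hi b).const_mul _)) fun x => ?_
      have h := sq_nonneg (s * fn a x ^ 2 - t * fn b x ^ 2)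
      have h2 : 2 * (fn a x * fn b x * (fn a x * fn b x))
        = 2 * (s * t) * (fn a x ^ 2 * fn b x ^ 2) := by rw [hst]; ring
      simp only [h2]
      nlinarith [h]
    rw [integral_add ((hi a).const_mul _) ((hi b).const_mul _), integral_const_mul,
      integral_const_mul] at h1
    have h2 := mul_le_mul_of_nonneg_left (hS.integral_pow_four_le a) (sq_nonneg s)
    have h3 := mul_le_mul_of_nonneg_left (hS.integral_pow_four_le b) (sq_nonneg t)
    calc _ ≤ _ := h1
      _ ≤ _ := add_le_add h2 h3
      _ = _ := by ring
  have hS0 := hS.nonneg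
  refine le_of_forall_pos_le_add fun ε hε => ?_
  -- The optimal weight s² = B/A is undefined when A vanishes, and likewise its inverse when B does.
  -- Both are shifted by a small r, at a cost below ε.
  obtain ⟨r, hr, hr'⟩ : ∃ r > 0, S * (r * (A + B) + r ^ 2) ≤ ε := by
    refine ⟨min 1 (ε / ((S + 1) * (A + B + 1))), by positivity, ?_⟩
    set r := min 1 (ε / ((S + 1) * (A + B + 1)))
    have h1 : r ≤ 1 := min_le_left _ _
    have h2 : r * ((S + 1) * (A + B + 1)) ≤ ε :=
      (le_div_iff₀ (by positivity)).1 (min_le_right _ _)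
    have h0 : 0 < r := by positivity
    calc S * (r * (A + B) + r ^ 2) ≤ (S + 1) * (r * (A + B) + r * 1) := by
          have : 0 ≤ r * (A + B) := by positivity
          gcongr
          · linarith
          · nlinarith
      _ = r * ((S + 1) * (A + B + 1)) := by ring
      _ ≤ ε := h2
  have hAr : 0 < A + r := by positivity
  have hBr : 0 < B + r := by positivity
  have hs0 : 0 < √((B + r) / (A + r)) := by positivity
  have h := key √((B + r) / (A + r)) √((A + r) / (B + r)) (by
    rw [← Real.sqrt_mul (by positivity)]
    rw [show (B + r) / (A + r) * ((A + r) / (B + r)) = 1 by field_simp, Real.sqrt_one])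
  rw [mul_pow, mul_pow, Real.sq_sqrt (by positivity), Real.sq_sqrt (by positivity)] at h
  have e1 : (B + r) / (A + r) * A ^ 2 ≤ (B + r) * (A + r) := by
    rw [div_mul_eq_mul_div, div_le_iff₀ hAr]
    nlinarith [mul_nonneg hBr.le (by nlinarith [mul_nonneg hA0 hr.le] : 0 ≤ (A + r) ^ 2 - A ^ 2)]
  have e2 : (A + r) / (B + r) * B ^ 2 ≤ (B + r) * (A + r) := by
    rw [div_mul_eq_mul_div, div_le_iff₀ hBr]
    nlinarith [mul_nonneg hAr.le (by nlinarith [mul_nonneg hB0 hr.le] : 0 ≤ (B + r) ^ 2 - B ^ 2)]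
  have h4 := mul_le_mul_of_nonneg_left (add_le_add e1 e2) hS0
  nlinarith

/-- The quadrilinear interaction form
`(a, b, c, e) ↦ ∑ᵢⱼ κᵢⱼ ∫ aᵢ bᵢ cⱼ eⱼ`. -/
def quad (K : Matrix (Fin p) (Fin p) ℝ) (a b c e : Frame Ω p) : ℝ :=
  ∑ j, ∑ i, K i j * prodIntegral (a i) (b i) (c j) (e j)

/-! ### Algebra of the forms and of the interaction -/

section Forms

variable {V : Fin p → EuclideanSpace ℝ (Fin d) → ℝ} {K : Matrix (Fin p) (Fin p) ℝ} {S : ℝ}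

theorem SobolevEmbedding.integrable_rho (hS : SobolevEmbedding Ω S) (φ : Frame Ω p)
    (u w : H01 Ω) (j : Fin p) :
    Integrable (fun x => rho K φ j x * (fn u x * fn w x)) (volume.restrict Ω) := by
  have h : (fun x => rho K φ j x * (fn u x * fn w x))
      = fun x => ∑ i, K i j * ((fn (φ i) x * fn (φ i) x) * (fn u x * fn w x)) := by
    funext x
    rw [rho, Finset.sum_mul]
    exact Finset.sum_congr rfl fun i _ => by ring
  rw [h]
  exact integrable_finsetSum _ fun i _ => (hS.integrable_prod _ _ _ _).const_mul _

theorem SobolevEmbedding.integral_rho (hS : SobolevEmbedding Ω S) (φ : Frame Ω p)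
    (u w : H01 Ω) (j : Fin p) :
    ∫ x in Ω, rho K φ j x * (fn u x * fn w x)
      = ∑ i, K i j * prodIntegral (φ i) (φ i) u w := by
  have h : (fun x => rho K φ j x * (fn u x * fn w x))
      = fun x => ∑ i, K i j * ((fn (φ i) x * fn (φ i) x) * (fn u x * fn w x)) := by
    funext x
    rw [rho, Finset.sum_mul]
    exact Finset.sum_congr rfl fun i _ => by ring
  rw [h, integral_finsetSum _ fun i _ => (hS.integrable_prod _ _ _ _).const_mul _]
  exact Finset.sum_congr rfl fun i _ => integral_const_mul _ _

theorem SobolevEmbedding.aForm_eq (hS : SobolevEmbedding Ω S) (hV : IsPotential Ω V)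
    (φ v w : Frame Ω p) : aForm V K φ v w = innerH V v w + quad K φ φ v w := by
  rw [aForm, innerH_eq_sum, quad, ← Finset.sum_add_distrib]
  refine Finset.sum_congr rfl fun j _ => ?_
  rw [← hS.integral_rho, compInner,
    ← integral_add (integrable_compInner (hV j).1 _ _) (hS.integrable_rho φ _ _ j)]

theorem SobolevEmbedding.energy_eq (hS : SobolevEmbedding Ω S) (hV : IsPotential Ω V)
    (φ : Frame Ω p) : energy V K φ = 1 / 2 * innerH V φ φ + 1 / 4 * quad K φ φ φ φ := by
  rw [energy, innerH_eq_sum, quad, Finset.mul_sum, Finset.mul_sum, ← Finset.sum_add_distrib]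
  refine Finset.sum_congr rfl fun j _ => ?_
  rw [← hS.integral_rho, compInner, ← integral_const_mul, ← integral_const_mul,
    ← integral_add ((integrable_compInner (hV j).1 _ _).const_mul _)
      ((hS.integrable_rho φ _ _ j).const_mul _)]
  congr 1 with x
  rw [real_inner_self_eq_norm_sq]
  ring

theorem innerH_comm (v w : Frame Ω p) : innerH V v w = innerH V w v := by
  simp only [innerH_eq_sum, compInner_comm _ (v _)]

theorem innerH_add_left (hV : IsPotential Ω V) (v v' w : Frame Ω p) :
    innerH V (v + v') w = innerH V v w + innerH V v' w := by
  simp only [innerH_eq_sum, Pi.add_apply, compInner_add_left (hV _).1, Finset.sum_add_distrib]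

theorem innerH_smul_left (c : ℝ) (v w : Frame Ω p) :
    innerH V (c • v) w = c * innerH V v w := by
  simp only [innerH_eq_sum, Pi.smul_apply, compInner_smul_left, Finset.mul_sum]

theorem innerH_add_right (hV : IsPotential Ω V) (v w w' : Frame Ω p) :
    innerH V v (w + w') = innerH V v w + innerH V v w' := by
  simp only [innerH_comm v, innerH_add_left hV]

theorem innerH_smul_right (c : ℝ) (v w : Frame Ω p) :
    innerH V v (c • w) = c * innerH V v w := by
  simp only [innerH_comm v, innerH_smul_left]

theorem innerH_scale_left (v w : Frame Ω p) (c : Fin p → ℝ) :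
    innerH V (scale v c) w = innerH V v (scale w c) := by
  simp only [innerH_eq_sum, scale]
  refine Finset.sum_congr rfl fun j _ => ?_
  rw [compInner_comm _ (v j), compInner_smul_left, compInner_smul_left, compInner_comm]

theorem compInner_self_nonneg (hV : IsPotential Ω V) (j : Fin p) (u : H01 Ω) :
    0 ≤ compInner (V j) u u :=
  (integral_norm_grad_sq_nonneg u).trans
    (integral_norm_grad_sq_le_compInner (hV j).1 (hV j).2 u)

theorem innerH_self_nonneg (hV : IsPotential Ω V) (v : Frame Ω p) : 0 ≤ innerH V v v :=
  Finset.sum_nonneg fun j _ => compInner_self_nonneg hV j (v j)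

theorem compInner_le_innerH (hV : IsPotential Ω V) (v : Frame Ω p) (j : Fin p) :
    compInner (V j) (v j) (v j) ≤ innerH V v v :=
  Finset.single_le_sum (f := fun j => compInner (V j) (v j) (v j))
    (fun i _ => compInner_self_nonneg hV i (v i)) (Finset.mem_univ j)

theorem innerH_scale_self_le (hV : IsPotential Ω V) (v : Frame Ω p) {c : Fin p → ℝ} {D : ℝ}
    (hc : ∀ j, c j ^ 2 ≤ D) : innerH V (scale v c) (scale v c) ≤ D * innerH V v v := by
  rw [innerH_eq_sum, innerH_eq_sum, Finset.mul_sum]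
  refine Finset.sum_le_sum fun j _ => ?_
  simp only [scale]
  rw [compInner_smul_left, compInner_comm, compInner_smul_left, ← mul_assoc, ← sq]
  exact mul_le_mul_of_nonneg_right (hc j) (compInner_self_nonneg hV j (v j))

theorem innerH_add_self_le (hV : IsPotential Ω V) (v w : Frame Ω p) :
    innerH V (v + w) (v + w) ≤ 2 * innerH V v v + 2 * innerH V w w := by
  have h := innerH_self_nonneg hV (v + (-1 : ℝ) • w)
  simp only [innerH_add_left hV, innerH_add_right hV, innerH_smul_left, innerH_smul_right,
    innerH_comm w v] at h ⊢
  linarith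

theorem quad_swap_left (a b c e : Frame Ω p) : quad K a b c e = quad K b a c e := by
  simp only [quad, prodIntegral_swap_left (a _)]

theorem quad_swap_right (a b c e : Frame Ω p) : quad K a b c e = quad K a b e c := by
  simp only [quad, prodIntegral_swap_right _ _ (c _)]

theorem quad_swap_pairs (hK : K.IsHermitian) (a b c e : Frame Ω p) :
    quad K a b c e = quad K c e a b := by
  simp only [quad]
  rw [Finset.sum_comm]
  refine Finset.sum_congr rfl fun i _ => Finset.sum_congr rfl fun j _ => ?_
  rw [prodIntegral_swap_pairs, ← hK.apply i j]
  simp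

theorem SobolevEmbedding.quad_add_first (hS : SobolevEmbedding Ω S) (a a' b c e : Frame Ω p) :
    quad K (a + a') b c e = quad K a b c e + quad K a' b c e := by
  simp only [quad, Pi.add_apply, hS.prodIntegral_add, mul_add, Finset.sum_add_distrib]

theorem quad_smul_first (t : ℝ) (a b c e : Frame Ω p) :
    quad K (t • a) b c e = t * quad K a b c e := by
  simp only [quad, Pi.smul_apply, prodIntegral_smul, Finset.mul_sum, mul_left_comm]

theorem SobolevEmbedding.quad_add_second (hS : SobolevEmbedding Ω S) (a b b' c e : Frame Ω p) :
    quad K a (b + b') c e = quad K a b c e + quad K a b' c e := by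
  simp only [quad_swap_left a, hS.quad_add_first]

theorem quad_smul_second (t : ℝ) (a b c e : Frame Ω p) :
    quad K a (t • b) c e = t * quad K a b c e := by
  simp only [quad_swap_left a, quad_smul_first]

theorem SobolevEmbedding.quad_add_third (hS : SobolevEmbedding Ω S) (hK : K.IsHermitian)
    (a b c c' e : Frame Ω p) :
    quad K a b (c + c') e = quad K a b c e + quad K a b c' e := by
  simp only [quad_swap_pairs hK a, hS.quad_add_first]

theorem quad_smul_third (hK : K.IsHermitian) (t : ℝ) (a b c e : Frame Ω p) :
    quad K a b (t • c) e = t * quad K a b c e := by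
  simp only [quad_swap_pairs hK a, quad_smul_first]

theorem SobolevEmbedding.quad_add_fourth (hS : SobolevEmbedding Ω S) (hK : K.IsHermitian)
    (a b c e e' : Frame Ω p) :
    quad K a b c (e + e') = quad K a b c e + quad K a b c e' := by
  simp only [quad_swap_pairs hK a, hS.quad_add_second]

theorem quad_smul_fourth (hK : K.IsHermitian) (t : ℝ) (a b c e : Frame Ω p) :
    quad K a b c (t • e) = t * quad K a b c e := by
  simp only [quad_swap_pairs hK a, quad_smul_second]

/-- The first pair enters only through the products aᵢbᵢ, so a diagonal factor passes from one
member to the other. This makes diagonal scalings self-adjoint for a_φ. -/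
theorem quad_scale_first (a b c e : Frame Ω p) (s : Fin p → ℝ) :
    quad K (scale a s) b c e = quad K a (scale b s) c e := by
  simp only [quad, scale]
  refine Finset.sum_congr rfl fun j _ => Finset.sum_congr rfl fun i _ => ?_
  rw [prodIntegral_swap_left (a i), prodIntegral_smul, prodIntegral_smul,
    prodIntegral_swap_left (a i)]

theorem quad_scale_third (hK : K.IsHermitian) (a b c e : Frame Ω p) (s : Fin p → ℝ) :
    quad K a b (scale c s) e = quad K a b c (scale e s) := by
  rw [quad_swap_pairs hK, quad_scale_first, quad_swap_pairs hK]

/-! ### Positivity and size of the interaction -/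

/-- Cauchy–Schwarz for AᵀKC, then Young's inequality. The sum of squares can be applied pointwise in
x and integrated term by term. -/
theorem abs_sum_le_spectralNorm (K : Matrix (Fin p) (Fin p) ℝ) (A C : Fin p → ℝ) :
    2 * |∑ j, ∑ i, K i j * (A i * C j)| ≤ spectralNorm K * (∑ i, A i ^ 2 + ∑ j, C j ^ 2) := by
  set a : EuclideanSpace ℝ (Fin p) := WithLp.toLp 2 A
  set c : EuclideanSpace ℝ (Fin p) := WithLp.toLp 2 C
  have h1 : ∑ j, ∑ i, K i j * (A i * C j)
      = inner ℝ a (Matrix.toEuclideanCLM (n := Fin p) (𝕜 := ℝ) K c) := by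
    rw [Finset.sum_comm]
    simp only [PiLp.inner_apply, Matrix.ofLp_toEuclideanCLM, Matrix.mulVec, dotProduct, a, c]
    refine Finset.sum_congr rfl fun i _ => ?_
    simp only [RCLike.inner_apply, conj_trivial]
    rw [Finset.sum_mul]
    exact Finset.sum_congr rfl fun j _ => by ring
  have h2 : |∑ j, ∑ i, K i j * (A i * C j)| ≤ ‖a‖ * (spectralNorm K * ‖c‖) := by
    rw [h1]
    exact (abs_real_inner_le_norm _ _).trans
      (mul_le_mul_of_nonneg_left (ContinuousLinearMap.le_opNorm _ _) (norm_nonneg _))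
  have ha : ‖a‖ ^ 2 = ∑ i, A i ^ 2 := by simp [EuclideanSpace.norm_sq_eq, a]
  have hc : ‖c‖ ^ 2 = ∑ i, C i ^ 2 := by simp [EuclideanSpace.norm_sq_eq, c]
  have hκ : 0 ≤ spectralNorm K := norm_nonneg _
  rw [← ha, ← hc]
  nlinarith [mul_nonneg hκ (sq_nonneg (‖a‖ - ‖c‖))]

theorem SobolevEmbedding.quad_eq_integral (hS : SobolevEmbedding Ω S) (a b c e : Frame Ω p) :
    quad K a b c e = ∫ x in Ω, ∑ j, ∑ i,
      K i j * ((fn (a i) x * fn (b i) x) * (fn (c j) x * fn (e j) x)) := by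
  rw [integral_finsetSum _ fun j _ =>
    integrable_finsetSum _ fun i _ => (hS.integrable_prod _ _ _ _).const_mul _]
  refine Finset.sum_congr rfl fun j _ => ?_
  rw [integral_finsetSum _ fun i _ => (hS.integrable_prod _ _ _ _).const_mul _]
  exact Finset.sum_congr rfl fun i _ => (integral_const_mul _ _).symm

/-- At each point the integrand is the quadratic form of K at the vector (aᵢbᵢ). The argument needs
the two pairs to agree; entries of K may be negative. -/
theorem SobolevEmbedding.quad_self_nonneg (hS : SobolevEmbedding Ω S) (hK : K.PosDef)
    (a b : Frame Ω p) : 0 ≤ quad K a b a b := by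
  rw [hS.quad_eq_integral]
  refine integral_nonneg fun x => ?_
  have h := hK.posSemidef.dotProduct_mulVec_nonneg (fun i => fn (a i) x * fn (b i) x)
  simp only [star_trivial, Matrix.mulVec, dotProduct] at h
  refine h.trans (le_of_eq ?_)
  rw [Finset.sum_comm]
  refine Finset.sum_congr rfl fun i _ => ?_
  rw [Finset.mul_sum]
  exact Finset.sum_congr rfl fun j _ => by ring

/-- Only one of the two factors is enlarged to the full norm; the other is summed over j. The
constant is thus independent of p. -/
theorem SobolevEmbedding.sum_prodIntegral_le (hS : SobolevEmbedding Ω S) (hV : IsPotential Ω V)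
    (a b : Frame Ω p) :
    ∑ j, prodIntegral (a j) (b j) (a j) (b j) ≤ S * (innerH V a a * innerH V b b) := by
  have hS0 := hS.nonneg
  calc ∑ j, prodIntegral (a j) (b j) (a j) (b j)
      ≤ ∑ j, S * (compInner (V j) (a j) (a j) * innerH V b b) := by
        refine Finset.sum_le_sum fun j _ => (hS.prodIntegral_self_le (a j) (b j)).trans ?_
        have h1 := integral_norm_grad_sq_le_compInner (hV j).1 (hV j).2 (a j)
        have h2 := (integral_norm_grad_sq_le_compInner (hV j).1 (hV j).2 (b j)).trans
          (compInner_le_innerH hV b j)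
        have h3 := integral_norm_grad_sq_nonneg (b j)
        have h4 := compInner_self_nonneg hV j (a j)
        gcongr
    _ = S * (innerH V a a * innerH V b b) := by
        rw [← Finset.mul_sum, ← Finset.sum_mul, innerH_eq_sum V a]

theorem SobolevEmbedding.abs_quad_le (hS : SobolevEmbedding Ω S) (hV : IsPotential Ω V)
    (a b c e : Frame Ω p) :
    2 * |quad K a b c e| ≤ spectralNorm K * S *
      (innerH V a a * innerH V b b + innerH V c c * innerH V e e) := by
  have hκ : 0 ≤ spectralNorm K := norm_nonneg _
  have hint : ∀ a b : Frame Ω p, Integrable (fun x => ∑ i, (fn (a i) x * fn (b i) x) ^ 2)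
      (volume.restrict Ω) := fun a b => integrable_finsetSum _ fun i _ => by
    simpa only [sq] using hS.integrable_prod (a i) (b i) (a i) (b i)
  have hsum : ∀ a b : Frame Ω p, ∫ x in Ω, ∑ i, (fn (a i) x * fn (b i) x) ^ 2
      = ∑ i, prodIntegral (a i) (b i) (a i) (b i) := fun a b => by
    simp only [sq]
    exact integral_finsetSum _ fun i _ => hS.integrable_prod (a i) (b i) (a i) (b i)
  have h1 : 2 * |quad K a b c e| ≤ ∫ x in Ω, spectralNorm K *
      (∑ i, (fn (a i) x * fn (b i) x) ^ 2 + ∑ i, (fn (c i) x * fn (e i) x) ^ 2) := by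
    have hi : Integrable (fun x => ∑ j, ∑ i,
        K i j * ((fn (a i) x * fn (b i) x) * (fn (c j) x * fn (e j) x))) (volume.restrict Ω) :=
      integrable_finsetSum _ fun j _ =>
        integrable_finsetSum _ fun i _ => (hS.integrable_prod _ _ _ _).const_mul _
    rw [hS.quad_eq_integral]
    refine (mul_le_mul_of_nonneg_left abs_integral_le_integral_abs zero_le_two).trans ?_
    rw [← integral_const_mul]
    exact integral_mono (hi.abs.const_mul 2) (((hint a b).add (hint c e)).const_mul _)
      fun x => abs_sum_le_spectralNorm K _ _
  rw [integral_const_mul, integral_add (hint a b) (hint c e), hsum, hsum] at h1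
  refine h1.trans ?_
  rw [mul_assoc]
  refine mul_le_mul_of_nonneg_left ?_ hκ
  rw [mul_add]
  exact add_le_add (hS.sum_prodIntegral_le hV a b) (hS.sum_prodIntegral_le hV c e)

end Forms

/-! ### Componentwise masses -/

section Out

theorem out_comm (v w : Frame Ω p) (j : Fin p) : out v w j = out w v j := by
  simp only [out, mul_comm]

theorem out_add_right (v w w' : Frame Ω p) (j : Fin p) :
    out v (w + w') j = out v w j + out v w' j := by
  unfold out
  rw [← integral_add (integrable_fn_mul_fn (v j) (w j)) (integrable_fn_mul_fn (v j) (w' j))]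
  refine integral_congr_ae ?_
  filter_upwards [fn_add (w j) (w' j)] with x h1
  rw [Pi.add_apply, h1]
  ring

theorem out_scale_right (v w : Frame Ω p) (c : Fin p → ℝ) (j : Fin p) :
    out v (scale w c) j = c j * out v w j := by
  unfold out
  rw [← integral_const_mul]
  refine integral_congr_ae ?_
  filter_upwards [fn_smul (c j) (w j)] with x h1
  rw [scale, h1]
  ring

theorem out_smul_right (v w : Frame Ω p) (t : ℝ) (j : Fin p) :
    out v (t • w) j = t * out v w j :=
  out_scale_right v w (fun _ => t) j

theorem out_self_nonneg (v : Frame Ω p) (j : Fin p) : 0 ≤ out v v j :=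
  integral_nonneg fun _ => mul_self_nonneg _

theorem SobolevEmbedding.out_self_le {S : ℝ} (hS : SobolevEmbedding Ω S)
    {V : Fin p → EuclideanSpace ℝ (Fin d) → ℝ} (hV : IsPotential Ω V) (v : Frame Ω p)
    (j : Fin p) : out v v j ≤ S * innerH V v v := by
  have h1 := hS.integral_sq_le (v j)
  simp only [sq (fn _ _)] at h1
  exact h1.trans (mul_le_mul_of_nonneg_left
    ((integral_norm_grad_sq_le_compInner (hV j).1 (hV j).2 (v j)).trans
      (compInner_le_innerH hV v j)) hS.nonneg)

end Out

/-! ### Expansion of the energy and the Riemannian gradient -/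

section Descent

variable {V : Fin p → EuclideanSpace ℝ (Fin d) → ℝ} {K : Matrix (Fin p) (Fin p) ℝ} {S : ℝ}
  {N : Fin p → ℝ} {α : ℝ} {φ u g v w : Frame Ω p}

/-- The densities change by |φᵢ + t zᵢ|² - |φᵢ|² = 2(tφᵢ + t²zᵢ/2)zᵢ. The square of this change is
the last term, which is written in the form q(W,z,W,z) so that `abs_quad_le` applies. -/
theorem SobolevEmbedding.energy_add_smul (hS : SobolevEmbedding Ω S) (hV : IsPotential Ω V)
    (hK : K.IsHermitian) (φ z : Frame Ω p) (t : ℝ) :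
    energy V K (φ + t • z) = energy V K φ + t * aForm V K φ φ z + t ^ 2 / 2 * aForm V K φ z z
      + quad K (t • φ + (t ^ 2 / 2) • z) z (t • φ + (t ^ 2 / 2) • z) z := by
  simp only [hS.energy_eq hV, hS.aForm_eq hV, innerH_add_left hV, innerH_add_right hV,
    innerH_smul_left, innerH_smul_right, hS.quad_add_first, hS.quad_add_second,
    hS.quad_add_third hK, hS.quad_add_fourth hK, quad_smul_first, quad_smul_second,
    quad_smul_third hK, quad_smul_fourth hK]
  rw [innerH_comm z φ, quad_swap_left z φ φ φ, quad_swap_left z φ φ z, quad_swap_left z φ z φ,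
    quad_swap_left z φ z z, quad_swap_right φ φ z φ, quad_swap_right φ z z φ,
    quad_swap_right z z z φ, quad_swap_pairs hK z z φ φ, quad_swap_pairs hK z z φ z,
    quad_swap_pairs hK φ z φ φ]
  ring

theorem SobolevEmbedding.hasDerivAt_energy (hS : SobolevEmbedding Ω S) (hV : IsPotential Ω V)
    (hK : K.IsHermitian) (φ z : Frame Ω p) :
    HasDerivAt (fun t : ℝ => energy V K (φ + t • z)) (aForm V K φ φ z) 0 := by
  have h : (fun t : ℝ => energy V K (φ + t • z)) = fun t => energy V K φ
      + t * aForm V K φ φ z + t ^ 2 * (aForm V K φ z z / 2 + quad K φ z φ z)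
      + t ^ 3 * (quad K φ z z z) + t ^ 4 * (quad K z z z z / 4) := by
    funext t
    rw [hS.energy_add_smul hV hK]
    simp only [hS.quad_add_first, hS.quad_add_third hK, quad_smul_first, quad_smul_third hK]
    rw [quad_swap_pairs hK z z φ z]
    ring
  rw [h]
  have h1 := ((((hasDerivAt_id (0 : ℝ)).mul_const (aForm V K φ φ z)).const_add
    (energy V K φ)).add (((hasDerivAt_id (0 : ℝ)).pow 2).mul_const
      (aForm V K φ z z / 2 + quad K φ z φ z))).add
    (((hasDerivAt_id (0 : ℝ)).pow 3).mul_const (quad K φ z z z)) |>.add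
    (((hasDerivAt_id (0 : ℝ)).pow 4).mul_const (quad K z z z z / 4))
  refine h1.congr_deriv ?_
  simp

theorem SobolevEmbedding.aForm_comm (hS : SobolevEmbedding Ω S) (hV : IsPotential Ω V)
    (φ v w : Frame Ω p) : aForm V K φ v w = aForm V K φ w v := by
  rw [hS.aForm_eq hV, hS.aForm_eq hV, innerH_comm, quad_swap_right]

theorem SobolevEmbedding.aForm_add_right (hS : SobolevEmbedding Ω S) (hV : IsPotential Ω V)
    (hK : K.IsHermitian) (φ v w w' : Frame Ω p) :
    aForm V K φ v (w + w') = aForm V K φ v w + aForm V K φ v w' := by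
  simp only [hS.aForm_eq hV, innerH_add_right hV, hS.quad_add_fourth hK]
  ring

theorem SobolevEmbedding.aForm_smul_right (hS : SobolevEmbedding Ω S) (hV : IsPotential Ω V)
    (hK : K.IsHermitian) (φ v w : Frame Ω p) (t : ℝ) :
    aForm V K φ v (t • w) = t * aForm V K φ v w := by
  simp only [hS.aForm_eq hV, innerH_smul_right, quad_smul_fourth hK]
  ring

theorem SobolevEmbedding.aForm_add_smul_self (hS : SobolevEmbedding Ω S) (hV : IsPotential Ω V)
    (hK : K.IsHermitian) (φ v w : Frame Ω p) (t : ℝ) :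
    aForm V K φ (v + t • w) (v + t • w)
      = aForm V K φ v v + 2 * t * aForm V K φ v w + t ^ 2 * aForm V K φ w w := by
  rw [hS.aForm_add_right hV hK, hS.aForm_smul_right hV hK, hS.aForm_comm hV _ _ v,
    hS.aForm_comm hV _ _ w, hS.aForm_add_right hV hK, hS.aForm_smul_right hV hK,
    hS.aForm_add_right hV hK, hS.aForm_smul_right hV hK, hS.aForm_comm hV _ w v]
  ring

theorem SobolevEmbedding.aForm_scale_left (hS : SobolevEmbedding Ω S) (hV : IsPotential Ω V)
    (hK : K.IsHermitian) (φ v w : Frame Ω p) (c : Fin p → ℝ) :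
    aForm V K φ (scale v c) w = aForm V K φ v (scale w c) := by
  rw [hS.aForm_eq hV, hS.aForm_eq hV, innerH_scale_left, quad_scale_third hK]

theorem CoerciveWith.aForm_self_nonneg (hV : IsPotential Ω V) (hα : 0 < α)
    (h : CoerciveWith V K φ α) (v : Frame Ω p) : 0 ≤ aForm V K φ v v :=
  (mul_nonneg hα.le (innerH_self_nonneg hV v)).trans (h v)

theorem CoerciveWith.innerH_self_le (hα : 0 < α) (h : CoerciveWith V K φ α) (v : Frame Ω p) :
    innerH V v v ≤ aForm V K φ v v / α :=
  (le_div_iff₀' hα).2 (h v)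

/-- No coercivity constant is lost here, because the interaction of φ with itself is non-negative.
-/
theorem SobolevEmbedding.innerH_le_aForm (hS : SobolevEmbedding Ω S) (hV : IsPotential Ω V)
    (hK : K.PosDef) (φ : Frame Ω p) : innerH V φ φ ≤ aForm V K φ φ φ := by
  rw [hS.aForm_eq hV]
  linarith [hS.quad_self_nonneg hK φ φ]

theorem SobolevEmbedding.aForm_le_energy (hS : SobolevEmbedding Ω S) (hV : IsPotential Ω V)
    (φ : Frame Ω p) : aForm V K φ φ φ ≤ 4 * energy V K φ := by
  rw [hS.aForm_eq hV, hS.energy_eq hV]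
  linarith [innerH_self_nonneg hV φ]

theorem SobolevEmbedding.energy_le_aForm (hS : SobolevEmbedding Ω S) (hV : IsPotential Ω V)
    (hK : K.PosDef) (φ : Frame Ω p) : energy V K φ ≤ 1 / 2 * aForm V K φ φ φ := by
  rw [hS.aForm_eq hV, hS.energy_eq hV]
  linarith [hS.quad_self_nonneg hK φ φ]

/-- The number in question is a_φ(w,w) ≥ 0, where w keeps only component j of u. If it vanished,
a_φ(φ + tw, φ + tw) would be affine in t with slope 2 `out φ φ j` > 0, hence negative for some t. -/
theorem SobolevEmbedding.out_preimage_pos (hS : SobolevEmbedding Ω S) (hV : IsPotential Ω V)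
    (hK : K.IsHermitian) (hα : 0 < α) (hc : CoerciveWith V K φ α)
    (hu : IsHamiltonianPreimage V K φ φ u) {j : Fin p} (hj : 0 < out φ φ j) :
    0 < out φ u j := by
  set e : Fin p → ℝ := Pi.single j 1 with he
  have hsum : ∀ f : Fin p → ℝ, ∑ i, e i * f i = f j := fun f => by
    simp [he, Pi.single_apply]
  have h1 : aForm V K φ (scale u e) (scale u e) = out φ u j := by
    rw [hS.aForm_scale_left hV hK, hu]
    simp only [innerL, out_scale_right]
    rw [hsum fun i => e i * out φ u i]
    simp [he]
  have h2 : aForm V K φ (scale u e) φ = out φ φ j := by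
    rw [hS.aForm_scale_left hV hK, hu]
    simp only [innerL, out_scale_right]
    exact hsum _
  by_contra hcon
  have h0 : out φ u j = 0 :=
    le_antisymm (not_lt.1 hcon) (h1 ▸ hc.aForm_self_nonneg hV hα (scale u e))
  -- The multiplier makes the affine function equal to -1.
  have h3 := hc.aForm_self_nonneg hV hα
    (φ + (-(aForm V K φ φ φ + 1) / (2 * out φ φ j)) • scale u e)
  rw [hS.aForm_add_smul_self hV hK, hS.aForm_comm hV φ φ (scale u e), h1, h2, h0] at h3
  have h4 : 2 * (-(aForm V K φ φ φ + 1) / (2 * out φ φ j)) * out φ φ j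
      = -(aForm V K φ φ φ + 1) := by field_simp
  rw [h4] at h3
  linarith

/-- The frame subtracted from φ is a diagonal multiple of A_φ⁻¹φ, and a_φ(A_φ⁻¹φ Λ, z) = (φ, zΛ)_L =
0 for tangent z. The entries of Λ are those that make g tangent. -/
theorem SobolevEmbedding.gradient_spec (hS : SobolevEmbedding Ω S) (hV : IsPotential Ω V)
    (hK : K.IsHermitian) (hα : 0 < α) (hc : CoerciveWith V K φ α) (hN : ∀ j, 0 < N j)
    (hφ : φ ∈ obliqueManifold Ω N) (hu : IsHamiltonianPreimage V K φ φ u)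
    (hg : g = φ - scale u (fun j => N j * (out φ u j)⁻¹)) :
    g ∈ tangentSpace φ ∧ ∀ z ∈ tangentSpace φ, aForm V K φ g z = aForm V K φ φ z := by
  have hg' : g = φ + (-1 : ℝ) • scale u (fun j => N j * (out φ u j)⁻¹) := by
    rw [hg, neg_one_smul, sub_eq_add_neg]
  refine ⟨fun j => ?_, fun z hz => ?_⟩
  · have hpos := hS.out_preimage_pos hV hK hα hc hu (j := j) (by rw [hφ j]; exact hN j)
    rw [hg', out_add_right, out_smul_right, out_scale_right, hφ j]
    field_simp
    ring
  · rw [hS.aForm_comm hV, hg', hS.aForm_add_right hV hK, hS.aForm_smul_right hV hK,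
      hS.aForm_comm hV _ z (scale _ _), hS.aForm_scale_left hV hK, hu, hS.aForm_comm hV _ z φ]
    have h0 : innerL φ (scale z fun j => N j * (out φ u j)⁻¹) = 0 :=
      Finset.sum_eq_zero fun j _ => by rw [out_scale_right, hz j, mul_zero]
    rw [h0]
    ring

theorem SobolevEmbedding.isRiemannianGradient (hS : SobolevEmbedding Ω S)
    (hV : IsPotential Ω V) (hK : K.IsHermitian) (hg : g ∈ tangentSpace φ)
    (hg' : ∀ z ∈ tangentSpace φ, aForm V K φ g z = aForm V K φ φ z) :
    IsRiemannianGradient V K φ g :=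
  ⟨hg, fun z hz => hg' z hz ▸ hS.hasDerivAt_energy hV hK φ z⟩

/-- Pythagoras: a_φ(φ - g, φ - g) = a_φ(φ,φ) - a_φ(g,g). -/
theorem SobolevEmbedding.aForm_gradient_le (hS : SobolevEmbedding Ω S) (hV : IsPotential Ω V)
    (hK : K.IsHermitian) (hα : 0 < α) (hc : CoerciveWith V K φ α)
    (hg : aForm V K φ g g = aForm V K φ φ g) : aForm V K φ g g ≤ aForm V K φ φ φ := by
  have h := hc.aForm_self_nonneg hV hα (φ + (-1 : ℝ) • g)
  rw [hS.aForm_add_smul_self hV hK, ← hg] at h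
  linarith

/-! ### Decrease of the energy before normalisation -/

/-- The factor of the second-order term in the decay of the energy along the negative gradient. -/
def descentConst (κ S α B : ℝ) : ℝ := 1 / 2 + κ * S * (2 * B + B / (2 * α)) / α

/-- The factor of the second-order term caused by the normalisation. -/
def normaliseConst (κ S α ν B : ℝ) : ℝ := κ * S * (S / (α * ν)) * (2 * B + 2 * B / α) ^ 2

theorem SobolevEmbedding.energy_gradient_step_le (hS : SobolevEmbedding Ω S)
    (hV : IsPotential Ω V) (hK : K.PosDef) (hα : 0 < α) (hc : CoerciveWith V K φ α)
    (hg : aForm V K φ g g = aForm V K φ φ g) {B τ : ℝ} (hB : aForm V K φ φ φ ≤ B)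
    (hτ0 : 0 ≤ τ) (hτ1 : τ ≤ 1) :
    energy V K (φ - τ • g) ≤ energy V K φ - τ * aForm V K φ g g
      + τ ^ 2 * descentConst (spectralNorm K) S α B * aForm V K φ g g := by
  have hκ : 0 ≤ spectralNorm K := norm_nonneg _
  have hS0 := hS.nonneg
  have hGB := (hS.aForm_gradient_le hV hK.1 hα hc hg).trans hB
  have hG0 := hc.aForm_self_nonneg hV hα g
  have hhg := hc.innerH_self_le hα g
  have hhφ := (hS.innerH_le_aForm hV hK φ).trans hB
  have hhg0 := innerH_self_nonneg hV g
  have hhφ0 := innerH_self_nonneg hV φ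
  set G := aForm V K φ g g with hG
  set W : Frame Ω p := (-τ) • φ + ((-τ) ^ 2 / 2) • g with hW
  -- W carries a factor τ, so the remainder q(W,g,W,g) is of order τ² and still contains h(g,g) ≤
  -- a_φ(g,g)/α.
  have hhW : innerH V W W ≤ τ ^ 2 * (2 * B + B / (2 * α)) := by
    have h1 := innerH_add_self_le hV ((-τ) • φ) (((-τ) ^ 2 / 2) • g)
    rw [← hW] at h1
    simp only [innerH_smul_left, innerH_smul_right] at h1
    have h2 : innerH V g g ≤ B / α := hhg.trans (by gcongr)
    have h3 : τ ^ 2 ≤ 1 := by nlinarith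
    have h4 : τ ^ 2 * innerH V g g ≤ 1 * (B / α) := by
      gcongr
    calc innerH V W W ≤ _ := h1
      _ = τ ^ 2 * (2 * innerH V φ φ + 1 / 2 * (τ ^ 2 * innerH V g g)) := by ring
      _ ≤ τ ^ 2 * (2 * B + 1 / 2 * (1 * (B / α))) := by gcongr
      _ = τ ^ 2 * (2 * B + B / (2 * α)) := by field_simp
  have hq : quad K W g W g
      ≤ spectralNorm K * S * ((τ ^ 2 * (2 * B + B / (2 * α))) * (G / α)) := by
    have h1 := hS.abs_quad_le hV (K := K) W g W g
    have h2 := le_abs_self (quad K W g W g)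
    have h3 : quad K W g W g ≤ spectralNorm K * S * (innerH V W W * innerH V g g) := by
      linarith
    refine h3.trans ?_
    have := innerH_self_nonneg hV W
    have := this.trans hhW
    gcongr
  rw [sub_eq_add_neg, ← neg_smul, hS.energy_add_smul hV hK.1, ← hW, ← hG, ← hg, descentConst]
  refine (add_le_add_right hq _).trans (le_of_eq ?_)
  ring

theorem SobolevEmbedding.innerH_gradient_step_le (hS : SobolevEmbedding Ω S)
    (hV : IsPotential Ω V) (hK : K.PosDef) (hα : 0 < α) (hc : CoerciveWith V K φ α)
    (hg : aForm V K φ g g = aForm V K φ φ g) {B τ : ℝ} (hB : aForm V K φ φ φ ≤ B)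
    (hτ0 : 0 ≤ τ) (hτ1 : τ ≤ 1) :
    innerH V (φ - τ • g) (φ - τ • g) ≤ 2 * B + 2 * B / α := by
  have hGB := (hS.aForm_gradient_le hV hK.1 hα hc hg).trans hB
  have hhg : innerH V g g ≤ B / α := (hc.innerH_self_le hα g).trans (by gcongr)
  have hhφ := (hS.innerH_le_aForm hV hK φ).trans hB
  have h1 := innerH_add_self_le hV φ ((-τ) • g)
  rw [neg_smul, ← sub_eq_add_neg, ← neg_smul] at h1
  simp only [innerH_smul_left, innerH_smul_right] at h1
  have h3 : τ ^ 2 ≤ 1 := by nlinarith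
  have h4 : τ ^ 2 * innerH V g g ≤ 1 * (B / α) := by
    have := innerH_self_nonneg hV g
    gcongr
  calc _ ≤ _ := h1
    _ = 2 * innerH V φ φ + 2 * (τ ^ 2 * innerH V g g) := by ring
    _ ≤ 2 * B + 2 * (1 * (B / α)) := by gcongr
    _ = _ := by ring

/-- The cross term vanishes by tangency. Masses do not decrease, so the normalisation is well
defined and only shrinks. -/
theorem out_gradient_step (hg : g ∈ tangentSpace φ) (τ : ℝ) (j : Fin p) :
    out (φ - τ • g) (φ - τ • g) j = out φ φ j + τ ^ 2 * out g g j := by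
  rw [sub_eq_add_neg, ← neg_smul, out_add_right, out_smul_right, out_comm _ φ, out_comm _ g,
    out_add_right, out_add_right, out_smul_right, out_smul_right, out_comm g φ, hg j]
  ring

/-! ### Effect of the normalisation on the energy -/

theorem normalise_mem_obliqueManifold (hN : ∀ j, 0 < N j) (hv : ∀ j, 0 < out v v j) :
    normalise N v ∈ obliqueManifold Ω N := by
  intro j
  rw [normalise, out_scale_right, out_comm (scale v _) v, out_scale_right, ← mul_assoc, ← sq, mul_pow, inv_pow,
    Real.sq_sqrt (hv j).le, Real.sq_sqrt (hN j).le]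
  have := (hv j).ne'
  field_simp

theorem normalise_factor_bounds {n o : ℝ} (hn : 0 < n) (ho : 0 ≤ o) :
    ((√(n + o))⁻¹ * √n) ^ 2 ≤ 1 ∧ 1 - ((√(n + o))⁻¹ * √n) ^ 2 ≤ o / n := by
  have h1 : ((√(n + o))⁻¹ * √n) ^ 2 = n / (n + o) := by
    rw [mul_pow, inv_pow, Real.sq_sqrt (by positivity), Real.sq_sqrt hn.le]
    field_simp
  rw [h1]
  refine ⟨(div_le_one (by positivity)).2 (by linarith), ?_⟩
  have h2 : 1 - n / (n + o) = o / (n + o) := by field_simp; ring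
  rw [h2]
  exact div_le_div_of_nonneg_left ho hn (by linarith)

theorem SobolevEmbedding.energy_scale_le_of_nonneg (hS : SobolevEmbedding Ω S)
    (hV : IsPotential Ω V)
    (h : ∀ i j, 0 ≤ K i j * prodIntegral (v i) (v i) (v j) (v j)) {s : Fin p → ℝ}
    (hs : ∀ j, s j ^ 2 ≤ 1) : energy V K (scale v s) ≤ energy V K v := by
  have h1 := innerH_scale_self_le hV v hs
  have h2 : quad K (scale v s) (scale v s) (scale v s) (scale v s) ≤ quad K v v v v := by
    refine Finset.sum_le_sum fun j _ => Finset.sum_le_sum fun i _ => ?_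
    have e : K i j * prodIntegral (scale v s i) (scale v s i) (scale v s j) (scale v s j)
        = s i ^ 2 * s j ^ 2 * (K i j * prodIntegral (v i) (v i) (v j) (v j)) := by
      simp only [scale]
      rw [prodIntegral_smul, prodIntegral_swap_left, prodIntegral_smul, prodIntegral_swap_pairs,
        prodIntegral_smul, prodIntegral_swap_left, prodIntegral_smul, prodIntegral_swap_pairs]
      ring
    rw [e]
    exact mul_le_of_le_one_left (h i j) (mul_le_one₀ (hs i) (sq_nonneg _) (hs j))
  rw [hS.energy_eq hV, hS.energy_eq hV]
  linarith

/-- When entries of K are negative, shrinking can raise the interaction energy. With x = vs² the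
scaled interaction is q(x,v,x,v). As x differs from v by D times a frame no larger than v, a
difference of squares bounds the change linearly in D. -/
theorem SobolevEmbedding.energy_scale_le (hS : SobolevEmbedding Ω S) (hV : IsPotential Ω V)
    (hK : K.IsHermitian) (v : Frame Ω p) {s : Fin p → ℝ} {D : ℝ} (hs : ∀ j, s j ^ 2 ≤ 1)
    (hD0 : 0 ≤ D) (hD : ∀ j, 1 - s j ^ 2 ≤ D) :
    energy V K (scale v s) ≤ energy V K v + spectralNorm K * S * D * innerH V v v ^ 2 := by
  have hκ : 0 ≤ spectralNorm K := norm_nonneg _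
  have hS0 := hS.nonneg
  have h1 := innerH_scale_self_le hV v hs
  have hh0 := innerH_self_nonneg hV v
  set x : Frame Ω p := scale v (fun j => s j ^ 2) with hx
  have hsx : scale (scale v s) s = x := by
    funext j
    simp only [scale, hx, smul_smul, sq]
  have hq : quad K (scale v s) (scale v s) (scale v s) (scale v s) = quad K x v x v := by
    rw [← quad_scale_first, ← quad_scale_third hK, hsx]
  -- δ = (1 - s²)/D, where D = 0 forces s² = 1 and δ = 0 serves.
  obtain ⟨δ, hδ, hδ'⟩ : ∃ δ : Fin p → ℝ, (∀ j, δ j ^ 2 ≤ 1) ∧ ∀ j, D * δ j = 1 - s j ^ 2 := by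
    rcases hD0.eq_or_lt with h0 | hpos
    · refine ⟨0, by simp, fun j => ?_⟩
      have := hD j
      have := hs j
      simp only [Pi.zero_apply]
      linarith
    · refine ⟨fun j => (1 - s j ^ 2) / D, fun j => ?_, fun j => by field_simp⟩
      have h2 : 0 ≤ (1 - s j ^ 2) / D := div_nonneg (by linarith [hs j]) hpos.le
      exact pow_le_one₀ h2 ((div_le_one hpos).2 (hD j))
  have hxδ : x = v + (-D) • scale v δ := by
    funext j
    simp only [hx, scale, Pi.add_apply, Pi.smul_apply, smul_smul]
    rw [neg_mul, hδ' j, ← one_smul ℝ (v j), smul_smul, smul_smul, ← add_smul]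
    congr 1
    ring
  have hdiff : quad K x v x v - quad K v v v v = -D * quad K (scale v δ) v (v + x) v := by
    have e1 : quad K x v (v + x) v = quad K v v (v + x) v - D * quad K (scale v δ) v (v + x) v := by
      conv_lhs => rw [hxδ, hS.quad_add_first, quad_smul_first, ← hxδ]
      ring
    simp only [hS.quad_add_third hK] at e1 ⊢
    rw [quad_swap_pairs hK x v v v, quad_swap_pairs hK v v x v] at e1
    have e2 : quad K v v v x = quad K v v x v := quad_swap_right _ _ _ _
    have e3 : quad K x v v v = quad K v v x v := quad_swap_pairs hK _ _ _ _
    linarith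
  have hhδ := innerH_scale_self_le hV v hδ
  have hhx : innerH V x x ≤ 1 * innerH V v v :=
    innerH_scale_self_le hV v fun j => pow_le_one₀ (sq_nonneg _) (hs j)
  have hhvx := innerH_add_self_le hV v x
  have habs := hS.abs_quad_le hV (K := K) (scale v δ) v (v + x) v
  -- Here h(v + x, v + x) ≤ 4h(v,v), so the factor would be 5/2. It is rounded up to 4 to cancel the
  -- 1/4 in the energy.
  have hbound : |quad K (scale v δ) v (v + x) v|
      ≤ 4 * (spectralNorm K * S * innerH V v v ^ 2) := by
    have h3 : innerH V (scale v δ) (scale v δ) * innerH V v v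
        + innerH V (v + x) (v + x) * innerH V v v
        ≤ (1 * innerH V v v) * innerH V v v + (4 * innerH V v v) * innerH V v v := by
      gcongr
      linarith
    have h4 := mul_le_mul_of_nonneg_left h3 (mul_nonneg hκ hS0)
    have h5 : 0 ≤ spectralNorm K * S * innerH V v v ^ 2 := by positivity
    nlinarith
  have h6 : -D * quad K (scale v δ) v (v + x) v
      ≤ D * (4 * (spectralNorm K * S * innerH V v v ^ 2)) := by
    have := mul_le_mul_of_nonneg_left ((neg_le_abs _).trans hbound) hD0
    linarith
  rw [hS.energy_eq hV, hS.energy_eq hV, hq]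
  linarith

theorem SobolevEmbedding.energy_normalise_le (hS : SobolevEmbedding Ω S)
    (hV : IsPotential Ω V) (hK : K.PosDef) (hα : 0 < α) (hc : CoerciveWith V K φ α)
    {ν : ℝ} (hν : 0 < ν) (hN : ∀ j, ν ≤ N j) (hφ : φ ∈ obliqueManifold Ω N)
    (hgt : g ∈ tangentSpace φ)
    (hg : aForm V K φ g g = aForm V K φ φ g) {B τ : ℝ} (hB : aForm V K φ φ φ ≤ B)
    (hτ0 : 0 ≤ τ) (hτ1 : τ ≤ 1) :
    energy V K (normalise N (φ - τ • g)) ≤ energy V K (φ - τ • g)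
      + τ ^ 2 * normaliseConst (spectralNorm K) S α ν B * aForm V K φ g g := by
  have hκ : 0 ≤ spectralNorm K := norm_nonneg _
  have hS0 := hS.nonneg
  have hG0 := hc.aForm_self_nonneg hV hα g
  have hhg := hc.innerH_self_le hα g
  have hhη := hS.innerH_gradient_step_le hV hK hα hc hg hB hτ0 hτ1
  have hhη0 := innerH_self_nonneg hV (φ - τ • g)
  have hb : ∀ j, _ := fun j => normalise_factor_bounds (n := N j) (o := τ ^ 2 * out g g j)
    (hν.trans_le (hN j)) (mul_nonneg (sq_nonneg _) (out_self_nonneg g j))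
  have hD : ∀ j, τ ^ 2 * out g g j / N j ≤ τ ^ 2 * (S * (aForm V K φ g g / α)) / ν := by
    intro j
    have h1 : out g g j ≤ S * (aForm V K φ g g / α) :=
      (hS.out_self_le hV g j).trans (by gcongr)
    have := hN j
    gcongr
  -- D bounds the relative mass gain τ²`out g g j`/Nⱼ by the Sobolev inequality, coercivity and Nⱼ ≥
  -- ν. It is proportional to τ² a_φ(g,g), and the error can be absorbed into the decay.
  have h := hS.energy_scale_le hV hK.1 (φ - τ • g)
    (s := fun j => (√(out (φ - τ • g) (φ - τ • g) j))⁻¹ * √(N j))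
    (D := τ ^ 2 * (S * (aForm V K φ g g / α)) / ν)
    (fun j => by rw [out_gradient_step hgt, hφ j]; exact (hb j).1) (by positivity)
    (fun j => by rw [out_gradient_step hgt, hφ j]; exact (hb j).2.trans (hD j))
  refine h.trans (add_le_add_right ?_ _)
  calc _ ≤ spectralNorm K * S * (τ ^ 2 * (S * (aForm V K φ g g / α)) / ν)
        * (2 * B + 2 * B / α) ^ 2 := by gcongr
    _ = _ := by
      rw [normaliseConst]
      field_simp

/-! ### Global coercivity forces a repulsive interaction -/

/-- If every `a_ψ` is coercive, the interaction is repulsive, and every `a_ψ` is coercive with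
constant `1`. -/
theorem SobolevEmbedding.quad_nonneg_of_coercive (hS : SobolevEmbedding Ω S)
    (hV : IsPotential Ω V)
    (h : ∀ ψ : Frame Ω p, ∃ α > 0, CoerciveWith V K ψ α) (ψ v : Frame Ω p) :
    0 ≤ quad K ψ ψ v v := by
  -- Coercivity of a_{tψ} is used for all t; a negative q(ψ,ψ,v,v) would be decisive for large t.
  have key : ∀ t : ℝ, 0 ≤ innerH V v v + t ^ 2 * quad K ψ ψ v v := by
    intro t
    obtain ⟨α, hα, hc⟩ := h (t • ψ)
    have h1 := hc.aForm_self_nonneg hV hα v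
    rw [hS.aForm_eq hV, quad_smul_first, quad_smul_second] at h1
    linarith
  have hh := innerH_self_nonneg hV v
  by_contra! hneg
  have h2 := key √((innerH V v v + 1) / -quad K ψ ψ v v)
  rw [Real.sq_sqrt (div_nonneg (by linarith) (by linarith))] at h2
  have h3 : (innerH V v v + 1) / -quad K ψ ψ v v * quad K ψ ψ v v = -(innerH V v v + 1) := by
    have := hneg.ne
    field_simp
  rw [h3] at h2
  linarith

/-- Frames with a single non-zero component isolate one entry of K. -/
theorem prodIntegral_nonneg_of_quad_nonneg
    (h : ∀ ψ v : Frame Ω p, 0 ≤ quad K ψ ψ v v) (v : Frame Ω p) (i j : Fin p) :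
    0 ≤ K i j * prodIntegral (v i) (v i) (v j) (v j) := by
  have h0 : ∀ b c e : H01 Ω, prodIntegral 0 b c e = 0 := fun b c e => by
    simpa using prodIntegral_smul 0 0 b c e
  have h1 := h (Pi.single i (v i)) (Pi.single j (v j))
  rw [quad, Finset.sum_eq_single j, Finset.sum_eq_single i] at h1
  · simpa using h1
  · intro k _ hk
    rw [Pi.single_eq_of_ne hk, h0, mul_zero]
  · simp
  · intro k _ hk
    refine Finset.sum_eq_zero fun l _ => ?_
    rw [Pi.single_eq_of_ne hk, prodIntegral_swap_pairs, h0, mul_zero]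
  · simp

/-! ### Induction over the iterates -/

/-- Energy decay in all steps, given that a step from an iterate of bounded energy norm decreases
the energy up to a second-order term. -/
theorem SobolevEmbedding.boundedWithDecay (hS : SobolevEmbedding Ω S) (hV : IsPotential Ω V)
    (hK : K.PosDef) (hN : ∀ j, 0 < N j) {α : ℝ} (hα : 0 < α) {τ : ℕ → ℝ} {φ : ℕ → Frame Ω p}
    (hφ : IsEaRGD V K N τ φ) (hc : ∀ k, CoerciveWith V K (φ k) α) {R M τmin : ℝ}
    (hR : aNorm V K (φ 0) (φ 0) = R) (hτmin : 0 < τmin) (hτ : ∀ k, τmin ≤ τ k)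
    (hτM : ∀ k, τ k * M ≤ 1 / 2)
    (hstep : ∀ k g, φ k ∈ obliqueManifold Ω N → g ∈ tangentSpace (φ k) →
      aForm V K (φ k) g g = aForm V K (φ k) (φ k) g →
      aForm V K (φ k) (φ k) (φ k) ≤ 2 * R ^ 2 →
      energy V K (normalise N (φ k - τ k • g)) ≤ energy V K (φ k)
        - τ k * aForm V K (φ k) g g + τ k ^ 2 * M * aForm V K (φ k) g g) :
    BoundedWithDecay V K φ (√(2 * R ^ 2) + 1) τmin := by
  have hstep' : ∀ k, φ k ∈ obliqueManifold Ω N → aForm V K (φ k) (φ k) (φ k) ≤ 2 * R ^ 2 →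
      φ (k + 1) ∈ obliqueManifold Ω N ∧ ∃ g, IsRiemannianGradient V K (φ k) g ∧
        0 ≤ aForm V K (φ k) g g ∧
        1 / 2 * τmin * aForm V K (φ k) g g ≤ energy V K (φ k) - energy V K (φ (k + 1)) := by
    intro k hk hkB
    obtain ⟨u, hu, hnext⟩ := hφ.2 k
    obtain ⟨hgt, hg⟩ := hS.gradient_spec hV hK.1 hα (hc k) hN hk hu rfl
    set g := φ k - scale u (fun j => N j * (out (φ k) u j)⁻¹)
    have hG0 := (hc k).aForm_self_nonneg hV hα g
    have hpos : ∀ j, 0 < out (φ k - τ k • g) (φ k - τ k • g) j := fun j => by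
      rw [out_gradient_step hgt, hk j]
      exact add_pos_of_pos_of_nonneg (hN j) (mul_nonneg (sq_nonneg _) (out_self_nonneg g j))
    refine ⟨hnext ▸ normalise_mem_obliqueManifold hN hpos, g,
      hS.isRiemannianGradient hV hK.1 hgt hg, hG0, ?_⟩
    have h := hstep k g hk hgt (hg g hgt) hkB
    rw [← hnext] at h
    have hτ0 : 0 ≤ τ k := hτmin.le.trans (hτ k)
    have h1 : τ k * (τ k * M) * aForm V K (φ k) g g ≤ τ k * (1 / 2) * aForm V K (φ k) g g :=
      mul_le_mul_of_nonneg_right (mul_le_mul_of_nonneg_left (hτM k) hτ0) hG0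
    have h2 := mul_le_mul_of_nonneg_right (hτ k) hG0
    nlinarith
  have hR2 : aForm V K (φ 0) (φ 0) (φ 0) = R ^ 2 := by
    rw [← hR, aNorm, Real.sq_sqrt ((hc 0).aForm_self_nonneg hV hα _)]
  have hB : ∀ k, energy V K (φ k) ≤ 1 / 2 * R ^ 2 →
      aForm V K (φ k) (φ k) (φ k) ≤ 2 * R ^ 2 := fun k hk => by
    linarith [hS.aForm_le_energy hV (K := K) (φ k)]
  -- The induction carries a bound on the energy, because the form a_φ itself changes from step to
  -- step.
  have hind : ∀ k, φ k ∈ obliqueManifold Ω N ∧ energy V K (φ k) ≤ 1 / 2 * R ^ 2 := by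
    intro k
    induction k with
    | zero => exact ⟨hφ.1, hR2 ▸ hS.energy_le_aForm hV hK (φ 0)⟩
    | succ k ih =>
      obtain ⟨h1, g, -, h2, h3⟩ := hstep' k ih.1 (hB k ih.2)
      refine ⟨h1, ?_⟩
      have : 0 ≤ 1 / 2 * τmin * aForm V K (φ k) g g := by positivity
      linarith [ih.2]
  intro k
  refine ⟨(Real.sqrt_le_sqrt (hB k (hind k).2)).trans (by linarith), ?_⟩
  obtain ⟨-, g, hg, h2, h3⟩ := hstep' k (hind k).1 (hB k (hind k).2)
  exact ⟨g, hg, by rw [aNorm, Real.sq_sqrt h2]; exact h3⟩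

end Descent

/-- The value 1/2 is what makes the step bound 1/(2M) at most 1. -/
theorem half_le_descentConst {κ S α B : ℝ} (hκ : 0 ≤ κ) (hS : 0 ≤ S) (hα : 0 < α) (hB : 0 ≤ B) :
    1 / 2 ≤ descentConst κ S α B := by
  rw [descentConst]
  have : 0 ≤ κ * S * (2 * B + B / (2 * α)) / α := by positivity
  linarith

theorem normaliseConst_nonneg {κ S α ν B : ℝ} (hκ : 0 ≤ κ) (hS : 0 ≤ S) (hα : 0 < α)
    (hν : 0 < ν) : 0 ≤ normaliseConst κ S α ν B := by
  rw [normaliseConst]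
  positivity

theorem mul_le_half_of_le {M τ : ℝ} (hM : 1 / 2 ≤ M) (hτ : τ ≤ 1 / (2 * M)) :
    τ * M ≤ 1 / 2 := by
  rw [le_div_iff₀ (by linarith)] at hτ
  linarith

theorem one_div_two_mul_le_one {M : ℝ} (hM : 1 / 2 ≤ M) : 1 / (2 * M) ≤ 1 :=
  (div_le_one (by linarith)).2 (by linarith)

end GrossPitaevskii

end

/-! ### Choice of the constants -/

theorem mainTheorem7 (d : ℕ) (hd : 1 ≤ d ∧ d ≤ 3) (Ω : Set (EuclideanSpace ℝ (Fin d)))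
    (hΩo : IsOpen Ω) (hΩne : Ω.Nonempty) (hΩb : Bornology.IsBounded Ω) (hΩc : Convex ℝ Ω)
    (κ R : ℝ) :
    (∃ C₀ Cτ : ℝ, 0 < C₀ ∧ 0 < Cτ ∧ Cτ ≤ 1 ∧
      ∀ (p : ℕ) (_ : 1 ≤ p) (N : Fin p → ℝ) (_ : ∀ j, 0 < N j)
        (V : Fin p → EuclideanSpace ℝ (Fin d) → ℝ) (_ : GrossPitaevskii.IsPotential Ω V)
        (K : Matrix (Fin p) (Fin p) ℝ) (_ : K.PosDef)
        (_ : GrossPitaevskii.spectralNorm K = κ)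
        (_ : ∀ ψ : GrossPitaevskii.Frame Ω p, ∃ α > 0, GrossPitaevskii.CoerciveWith V K ψ α)
        (τ : ℕ → ℝ) (φ : ℕ → GrossPitaevskii.Frame Ω p)
        (_ : GrossPitaevskii.IsEaRGD V K N τ φ)
        (_ : GrossPitaevskii.aNorm V K (φ 0) (φ 0) = R)
        (τmin τmax : ℝ) (_ : 0 < τmin) (_ : ∀ k, τmin ≤ τ k ∧ τ k ≤ τmax) (_ : τmax ≤ Cτ),
        GrossPitaevskii.BoundedWithDecay V K φ C₀ τmin) ∧
    (∀ α ν : ℝ, 0 < α → 0 < ν → ∃ C₀ Cτ : ℝ, 0 < C₀ ∧ 0 < Cτ ∧ Cτ ≤ 1 ∧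
      ∀ (p : ℕ) (_ : 1 ≤ p) (N : Fin p → ℝ) (_ : ∀ j, ν ≤ N j)
        (V : Fin p → EuclideanSpace ℝ (Fin d) → ℝ) (_ : GrossPitaevskii.IsPotential Ω V)
        (K : Matrix (Fin p) (Fin p) ℝ) (_ : K.PosDef)
        (_ : GrossPitaevskii.spectralNorm K = κ)
        (τ : ℕ → ℝ) (φ : ℕ → GrossPitaevskii.Frame Ω p)
        (_ : GrossPitaevskii.IsEaRGD V K N τ φ)
        (_ : ∀ k, GrossPitaevskii.CoerciveWith V K (φ k) α)
        (_ : GrossPitaevskii.aNorm V K (φ 0) (φ 0) = R)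
        (τmin τmax : ℝ) (_ : 0 < τmin) (_ : ∀ k, τmin ≤ τ k ∧ τ k ≤ τmax) (_ : τmax ≤ Cτ),
        GrossPitaevskii.BoundedWithDecay V K φ C₀ τmin) := by
  obtain ⟨S, hS⟩ := GrossPitaevskii.exists_sobolevEmbedding (Ω := Ω) hd hΩb
  have hB : (0 : ℝ) ≤ 2 * R ^ 2 := by positivity
  refine ⟨?_, fun α ν hα hν => ?_⟩
  · have hM := GrossPitaevskii.half_le_descentConst (abs_nonneg κ) hS.nonneg one_pos hB
    -- The summand 1 keeps C₀ positive when R = 0, and |κ| keeps the constants meaningful for every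
    -- real κ, since both are fixed before K is.
    refine ⟨√(2 * R ^ 2) + 1, 1 / (2 * GrossPitaevskii.descentConst |κ| S 1 (2 * R ^ 2)),
      by positivity, by positivity, GrossPitaevskii.one_div_two_mul_le_one hM, ?_⟩
    intro p _ N hN V hV K hK hκ hcoer τ φ hφ hR τmin τmax hτmin hτ hτmax
    have hκ' : |κ| = GrossPitaevskii.spectralNorm K := by
      rw [← hκ]
      exact abs_of_nonneg (norm_nonneg _)
    have hq := hS.quad_nonneg_of_coercive hV hcoer
    -- A non-negative interaction gives a_ψ(v,v) ≥ h(v,v), so the unknown coercivity constants are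
    -- replaced by 1.
    have hc : ∀ ψ : GrossPitaevskii.Frame Ω p, GrossPitaevskii.CoerciveWith V K ψ 1 :=
      fun ψ v => by
        rw [hS.aForm_eq hV]
        linarith [hq ψ v]
    have hτC : ∀ k, τ k ≤ 1 / (2 * GrossPitaevskii.descentConst |κ| S 1 (2 * R ^ 2)) :=
      fun k => (hτ k).2.trans hτmax
    refine hS.boundedWithDecay hV hK hN one_pos hφ (fun k => hc (φ k)) hR hτmin
      (fun k => (hτ k).1) (fun k => GrossPitaevskii.mul_le_half_of_le hM (hτC k)) ?_
    intro k g hk hgt hg hkB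
    have hτ0 : 0 ≤ τ k := hτmin.le.trans (hτ k).1
    have hτ1 := (hτC k).trans (GrossPitaevskii.one_div_two_mul_le_one hM)
    have h1 := hS.energy_gradient_step_le hV hK one_pos (hc (φ k)) hg hkB hτ0 hτ1
    rw [hκ']
    refine le_trans ?_ h1
    refine hS.energy_scale_le_of_nonneg hV
      (GrossPitaevskii.prodIntegral_nonneg_of_quad_nonneg hq _) fun j => ?_
    rw [GrossPitaevskii.out_gradient_step hgt, hk j]
    exact (GrossPitaevskii.normalise_factor_bounds (hN j)
      (mul_nonneg (sq_nonneg _) (GrossPitaevskii.out_self_nonneg g j))).1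
  · have hM : 1 / 2 ≤ GrossPitaevskii.descentConst |κ| S α (2 * R ^ 2)
        + GrossPitaevskii.normaliseConst |κ| S α ν (2 * R ^ 2) :=
      (GrossPitaevskii.half_le_descentConst (abs_nonneg κ) hS.nonneg hα hB).trans
        (le_add_of_nonneg_right
          (GrossPitaevskii.normaliseConst_nonneg (abs_nonneg κ) hS.nonneg hα hν))
    refine ⟨√(2 * R ^ 2) + 1, 1 / (2 * (GrossPitaevskii.descentConst |κ| S α (2 * R ^ 2)
        + GrossPitaevskii.normaliseConst |κ| S α ν (2 * R ^ 2))),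
      by positivity, by positivity, GrossPitaevskii.one_div_two_mul_le_one hM, ?_⟩
    intro p _ N hN V hV K hK hκ τ φ hφ hc hR τmin τmax hτmin hτ hτmax
    have hκ' : |κ| = GrossPitaevskii.spectralNorm K := by
      rw [← hκ]
      exact abs_of_nonneg (norm_nonneg _)
    have hτC := fun k => (hτ k).2.trans hτmax
    refine hS.boundedWithDecay hV hK (fun j => hν.trans_le (hN j)) hα hφ hc hR hτmin
      (fun k => (hτ k).1) (fun k => GrossPitaevskii.mul_le_half_of_le hM (hτC k)) ?_
    intro k g hk hgt hg hkB
    have hτ0 : 0 ≤ τ k := hτmin.le.trans (hτ k).1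
    have hτ1 := (hτC k).trans (GrossPitaevskii.one_div_two_mul_le_one hM)
    have h1 := hS.energy_gradient_step_le hV hK hα (hc k) hg hkB hτ0 hτ1
    have h2 := hS.energy_normalise_le hV hK hα (hc k) hν hN hk hgt hg hkB hτ0 hτ1
    rw [hκ']
    linarith
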